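/- Let $p$ be a prime number and let $\phi:(R,\mathfrak m)\to(S,\mathfrak n)$ be a flat local homomorphism of Noetherian local rings of characteristic $p$. Definitions. For a finitely generated module $M$ over a Noetherian local ring $(A,\mathfrak a)$ of characteristic $p$, let $F^e_A(M)$ be the base change of $M$ along the $e$-th iterate of the Frobenius endomorphism of $A$, and for $z\in M$ let $z^{p^e}=1\otimes z\in F^e_A(M)$; for a submodule $N\subseteq M$ let $N^{[p^e]}_M$ be the image of $F^e_A(N)\to F^e_A(M)$. Let $A^\circ$ be the complement of the union of the minimal primes of $A$. The tight closure $N^*_M$ is the set of $z\in M$ for which there are $c\in A^\circ$ and $e_0\ge 0$ such that $cz^{p^e}\in N^{[p^e]}_M$ for all $e\ge e_0$. An element $c\in A^\circ$ is a $q_0$-weak test element for $A$, where $q_0=p^{e_0}$, if $cz^{p^e}\in N^{[p^e]}_M$ for all $e\ge e_0$, all finitely generated $A$-modules $M$, all submodules $N\subseteq M$ and all $z\in N^*_M$. Put $G^e_A(M)=F^e_A(M)/0^*_{F^e_A(M)}$. The module $M$ satisfies avoidance if, for every quotient module $N$ of $M$ and every ideal $I$ of $A$ with $I\subseteq\bigcup_{e\ge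 0}\bigcup_{P\in\operatorname{Ass}G^e_A(N)}P$, there are $e\ge 0$ and $P\in\operatorname{Ass}G^e_A(N)$ with $I\subseteq P$. An element $x\in A$ is phantom $M$-regular if $xM\ne M$ and, for all $e\ge 0$, every element of $F^e_A(M)$ killed by $x^{p^e}$ lies in $0^*_{F^e_A(M)}$. A sequence $x_1,\dots,x_n$ in $A$ is a phantom $M$-regular sequence if $(x_1,\dots,x_n)M\ne M$ and each $x_i$ is phantom $M/(x_1,\dots,x_{i-1})M$-regular. The phantom depth $\operatorname{pdepth}_A M$ is the supremum of the lengths of the phantom $M$-regular sequences in $\mathfrak a$. A phantom $M$-regular sequence (respectively an $M$-regular sequence) in $\mathfrak a$ is maximal if it cannot be extended to a longer one by appending an element of $\mathfrak a$. A Cohen–Macaulay $A$ is called $F$-injective if, for every ideal $I$ of $A$ generated by a system of parameters and every $x\in A$, $x^p\in I^{[p]}$ implies $x\in I$, where $I^{[p]}$ is the ideal generated by the $p$-th powers of the elements of $I$. Theorem. Assume that the closed fiber $S/\mathfrak mS$ is Cohen–Macaulay and $F$-injective, and that $R$ and $S$ share a $q_0$-weak test element, that is, for some power $q_0$ of $p$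 there is $c\in R$ that is a $q_0$-weak test element for $R$ and whose image $\phi(c)$ is a $q_0$-weak test element for $S$. Let $M\neq 0$ be a finitely generated $R$-module satisfying avoidance. Then $$\operatorname{pdepth}_R M+\operatorname{depth} S/\mathfrak mS=\operatorname{pdepth}_S(S\otimes_R M),$$ and these numbers are finite. Moreover, if $\mathbf a$ is a maximal phantom $M$-regular sequence in $\mathfrak m$ and $\mathbf z$ is a maximal $S/\mathfrak mS$-regular sequence in $\mathfrak n$, then $\phi(\mathbf a),\mathbf z$ is a maximal phantom $(S\otimes_R M)$-regular sequence in $\mathfrak n$. -/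

import Mathlib

open TensorProduct

universe u v w

namespace PhantomDepth

/-! Frobenius powers of modules. -/

/-- The ring `R`, regarded as an `R`-algebra through the `e`-th iterate
`r ↦ r ^ (p ^ e)` of the Frobenius endomorphism. -/
def FrobRing (R : Type u) (_p _e : ℕ) : Type u := R

instance (R : Type u) [CommRing R] (p e : ℕ) : CommRing (FrobRing R p e) :=
  inferInstanceAs (CommRing R)

noncomputable instance (R : Type u) [CommRing R] (p e : ℕ) [Fact p.Prime] [CharP R p] :
    Algebra R (FrobRing R p e) :=
  RingHom.toAlgebra (iterateFrobenius R p e : R →+* R)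

/-- The `p ^ e`-th Frobenius power `F^e(M)`: the base change of `M` along the `e`-th iterate
of Frobenius. (Applied to a presentation of `M` by a matrix, base change raises all entries to
the power `p ^ e`, so this is the cokernel of the matrix of `p ^ e`-th powers.) -/
def FrobPow (R : Type u) [CommRing R] (p : ℕ) [Fact p.Prime] [CharP R p] (e : ℕ)
    (M : Type v) [AddCommGroup M] [Module R M] : Type (max u v) :=
  FrobRing R p e ⊗[R] M

section FrobPow

variable (R : Type u) [CommRing R] (p : ℕ) [Fact p.Prime] [CharP R p] (e : ℕ)

noncomputable instance (M : Type v) [AddCommGroup M] [Module R M] :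
    AddCommGroup (FrobPow R p e M) :=
  inferInstanceAs (AddCommGroup (FrobRing R p e ⊗[R] M))

/-- `R` acts on `F^e(M)` through the left tensor factor: `r • (a ⊗ m) = (r * a) ⊗ m`. -/
noncomputable instance (M : Type v) [AddCommGroup M] [Module R M] :
    Module R (FrobPow R p e M) :=
  inferInstanceAs (Module (FrobRing R p e) (FrobRing R p e ⊗[R] M))

/-- The element `z ^ (p ^ e)` of `F^e(M)` attached to `z : M`, that is, `1 ⊗ z`. -/
noncomputable def frobElt {M : Type v} [AddCommGroup M] [Module R M] (z : M) :
    FrobPow R p e M :=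
  (1 : FrobRing R p e) ⊗ₜ[R] z

/-- The map `F^e(f) : F^e(L) → F^e(M)` induced by an `R`-linear map `f : L → M`. -/
noncomputable def frobMap {L : Type v} {M : Type w} [AddCommGroup L] [Module R L]
    [AddCommGroup M] [Module R M] (f : L →ₗ[R] M) :
    FrobPow R p e L →ₗ[R] FrobPow R p e M :=
  (TensorProduct.AlgebraTensorModule.lTensor (FrobRing R p e) (FrobRing R p e) f :
    (FrobRing R p e ⊗[R] L) →ₗ[FrobRing R p e] (FrobRing R p e ⊗[R] M))

variable {M : Type v} [AddCommGroup M] [Module R M]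

/-- `N^{[p^e]}_M`: the image of `F^e(N)` in `F^e(M)`. -/
noncomputable def frobSubmodule (N : Submodule R M) : Submodule R (FrobPow R p e M) :=
  LinearMap.range (frobMap R p e N.subtype)

variable {R p e}

theorem frobElt_add (y z : M) :
    frobElt R p e (y + z) = frobElt R p e y + frobElt R p e z :=
  TensorProduct.tmul_add _ _ _

theorem frobElt_zero : frobElt R p e (0 : M) = 0 :=
  TensorProduct.tmul_zero _ _

theorem frobElt_smul (r : R) (z : M) :
    frobElt R p e (r • z) = r ^ p ^ e • frobElt R p e z := by
  have h : (1 : FrobRing R p e) ⊗ₜ[R] (r • z) =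
      (r • (1 : FrobRing R p e)) ⊗ₜ[R] z := (TensorProduct.smul_tmul _ _ _).symm
  have h2 : (r • (1 : FrobRing R p e)) ⊗ₜ[R] z =
      (algebraMap R (FrobRing R p e) r) • ((1 : FrobRing R p e) ⊗ₜ[R] z) := by
    rw [TensorProduct.smul_tmul', Algebra.smul_def, smul_eq_mul]
  have h3 : (algebraMap R (FrobRing R p e) r) • ((1 : FrobRing R p e) ⊗ₜ[R] z) =
      (r ^ p ^ e • frobElt R p e z : FrobPow R p e M) := rfl
  exact (h.trans h2).trans h3

end FrobPow

/-! Tight closure. -/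

/-- `R°`: the complement of the union of the minimal primes of `R`. -/
def minPrimesCompl (R : Type u) [CommRing R] : Set R :=
  {c | ∀ P ∈ minimalPrimes R, c ∉ P}

theorem one_mem_minPrimesCompl (R : Type u) [CommRing R] : (1 : R) ∈ minPrimesCompl R :=
  fun P hP h => hP.1.1.ne_top ((Ideal.eq_top_iff_one P).2 h)

theorem mul_mem_minPrimesCompl {R : Type u} [CommRing R] {a b : R}
    (ha : a ∈ minPrimesCompl R) (hb : b ∈ minPrimesCompl R) : a * b ∈ minPrimesCompl R :=
  fun P hP h => (hP.1.1.mem_or_mem h).elim (ha P hP) (hb P hP)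

section TightClosure

variable (R : Type u) [CommRing R] (p : ℕ) [Fact p.Prime] [CharP R p]

/-- The tight closure `N^*_M`: those `z` for which there are `c ∈ R°` and `e₀` with
`c z^{p^e} ∈ N^{[p^e]}_M` for all `e ≥ e₀`. -/
noncomputable def tightClosure {M : Type v} [AddCommGroup M] [Module R M]
    (N : Submodule R M) : Submodule R M where
  carrier := {z | ∃ c ∈ minPrimesCompl R, ∃ e₀ : ℕ, ∀ e ≥ e₀,
    c • frobElt R p e z ∈ frobSubmodule R p e N}
  zero_mem' := ⟨1, one_mem_minPrimesCompl R, 0, fun e _ => by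
    rw [frobElt_zero, smul_zero]; exact Submodule.zero_mem _⟩
  add_mem' := by
    rintro y z ⟨c, hc, e₁, h₁⟩ ⟨d, hd, e₂, h₂⟩
    refine ⟨c * d, mul_mem_minPrimesCompl hc hd, max e₁ e₂, fun e he => ?_⟩
    rw [frobElt_add, smul_add]
    refine Submodule.add_mem _ ?_ ?_
    · rw [mul_comm, mul_smul]
      exact Submodule.smul_mem _ _ (h₁ e (le_trans (le_max_left _ _) he))
    · rw [mul_smul]
      exact Submodule.smul_mem _ _ (h₂ e (le_trans (le_max_right _ _) he))
  smul_mem' := by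
    rintro r z ⟨c, hc, e₀, h⟩
    refine ⟨c, hc, e₀, fun e he => ?_⟩
    rw [frobElt_smul, smul_comm]
    exact Submodule.smul_mem _ _ (h e he)

/-- `c` is a `p ^ e₀`-weak test element for `R`: it lies in `R°`, and the pair `(c, e₀)`
witnesses every membership in the tight closure of a submodule of a finitely generated module.
(Up to isomorphism, every finitely generated module lives in the universe of `R`.) -/
def IsWeakTestElement (e₀ : ℕ) (c : R) : Prop :=
  c ∈ minPrimesCompl R ∧
    ∀ (M : Type u) [AddCommGroup M] [Module R M] [Module.Finite R M]
      (N : Submodule R M) (z : M), z ∈ tightClosure R p N →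
        ∀ e ≥ e₀, c • frobElt R p e z ∈ frobSubmodule R p e N

/-- The reduced Frobenius power `G^e(M) = F^e(M) / 0^*_{F^e(M)}`. -/
abbrev RedFrobPow (e : ℕ) (M : Type v) [AddCommGroup M] [Module R M] : Type (max u v) :=
  FrobPow R p e M ⧸ tightClosure R p (⊥ : Submodule R (FrobPow R p e M))

/-- `M` satisfies avoidance: for every quotient `N = M ⧸ K` of `M`, an ideal contained in the
union of all members of all the sets `Ass G^e(N)`, `e ≥ 0`, is contained in one of them. -/
def SatisfiesAvoidance (M : Type v) [AddCommGroup M] [Module R M] : Prop :=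
  ∀ (K : Submodule R M) (I : Ideal R),
    (I : Set R) ⊆ ⋃ e : ℕ, ⋃ P ∈ associatedPrimes R (RedFrobPow R p e (M ⧸ K)), (P : Set R) →
    ∃ e : ℕ, ∃ P ∈ associatedPrimes R (RedFrobPow R p e (M ⧸ K)), I ≤ P

/-! Phantom regular sequences and phantom depth. -/

/-- `x` is phantom `M`-regular: `xM ≠ M`, and for all `e` the annihilator of `x ^ (p ^ e)` in
`F^e(M)` is contained in `0^*_{F^e(M)}`. -/
def IsPhantomRegular (M : Type v) [AddCommGroup M] [Module R M] (x : R) : Prop :=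
  (Ideal.span {x} • ⊤ : Submodule R M) ≠ ⊤ ∧
    ∀ (e : ℕ) (z : FrobPow R p e M), x ^ p ^ e • z = 0 →
      z ∈ tightClosure R p (⊥ : Submodule R (FrobPow R p e M))

/-- `xs = x₁, …, xₙ` is a phantom `M`-regular sequence: `(x₁, …, xₙ)M ≠ M`, and each `xᵢ` is
phantom regular on `M / (x₁, …, xᵢ₋₁)M`. -/
def IsPhantomRegularSeq (M : Type v) [AddCommGroup M] [Module R M] (xs : List R) : Prop :=
  (Ideal.ofList xs • ⊤ : Submodule R M) ≠ ⊤ ∧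
    ∀ (i : ℕ) (hi : i < xs.length),
      IsPhantomRegular R p (M ⧸ (Ideal.ofList (xs.take i) • ⊤ : Submodule R M)) xs[i]

/-- `xs` is a maximal phantom `M`-regular sequence in the maximal ideal: it cannot be extended
by a further element of the maximal ideal. -/
def IsMaximalPhantomRegularSeq [IsLocalRing R] (M : Type v) [AddCommGroup M] [Module R M]
    (xs : List R) : Prop :=
  (∀ x ∈ xs, x ∈ IsLocalRing.maximalIdeal R) ∧ IsPhantomRegularSeq R p M xs ∧
    ∀ y ∈ IsLocalRing.maximalIdeal R, ¬ IsPhantomRegularSeq R p M (xs ++ [y])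

/-- The phantom depth of `M`: the supremum of the lengths of the phantom `M`-regular sequences
in the maximal ideal. -/
noncomputable def phantomDepth [IsLocalRing R] (M : Type v) [AddCommGroup M] [Module R M] : ℕ∞ :=
  ⨆ (xs : List R) (_ : (∀ x ∈ xs, x ∈ IsLocalRing.maximalIdeal R) ∧
    IsPhantomRegularSeq R p M xs), (xs.length : ℕ∞)

end TightClosure

/-! Depth, the Cohen-Macaulay property, `F`-injectivity, and the closed fiber. -/

section Local

variable (R : Type u) [CommRing R] [IsLocalRing R]

/-- `xs` is a maximal `M`-regular sequence in the maximal ideal. -/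
def IsMaximalRegularSeq (M : Type v) [AddCommGroup M] [Module R M] (xs : List R) : Prop :=
  (∀ x ∈ xs, x ∈ IsLocalRing.maximalIdeal R) ∧ RingTheory.Sequence.IsRegular M xs ∧
    ∀ y ∈ IsLocalRing.maximalIdeal R, ¬ RingTheory.Sequence.IsRegular M (xs ++ [y])

/-- The depth of `M`: the supremum of the lengths of the `M`-regular sequences in the maximal
ideal. -/
noncomputable def depth (M : Type v) [AddCommGroup M] [Module R M] : ℕ∞ :=
  ⨆ (xs : List R) (_ : (∀ x ∈ xs, x ∈ IsLocalRing.maximalIdeal R) ∧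
    RingTheory.Sequence.IsRegular M xs), (xs.length : ℕ∞)

/-- A (Noetherian) local ring is Cohen-Macaulay if its depth equals its dimension. -/
def IsCohenMacaulay : Prop :=
  ((depth R R : ℕ∞) : WithBot ℕ∞) = ringKrullDim R

/-- A system of parameters: `dim R` elements of the maximal ideal generating an ideal whose
radical is the maximal ideal. -/
def IsSystemOfParameters (xs : List R) : Prop :=
  (xs.length : WithBot ℕ∞) = ringKrullDim R ∧
    (Ideal.ofList xs).radical = IsLocalRing.maximalIdeal R

/-- `F`-injectivity of a Cohen-Macaulay local ring of characteristic `p`: for every ideal `I`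
generated by a system of parameters, `x ^ p ∈ I^{[p]}` implies `x ∈ I`, where `I^{[p]}` is the
ideal generated by the `p`-th powers of the elements of `I`. -/
def IsFInjective (p : ℕ) : Prop :=
  ∀ xs : List R, IsSystemOfParameters R xs →
    ∀ x : R, x ^ p ∈ Ideal.span ((fun y : R => y ^ p) '' (Ideal.ofList xs : Set R)) →
      x ∈ Ideal.ofList xs

end Local

section ClosedFiber

variable (R : Type u) (S : Type v) [CommRing R] [CommRing S] [IsLocalRing R] [IsLocalRing S]
  [Algebra R S]

/-- The closed fiber `S/𝔪S` of a homomorphism of local rings `(R, 𝔪) → (S, 𝔫)`. -/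
abbrev ClosedFiber : Type v :=
  S ⧸ (IsLocalRing.maximalIdeal R).map (algebraMap R S)

instance [IsLocalHom (algebraMap R S)] : IsLocalRing (ClosedFiber R S) := by
  have h : (IsLocalRing.maximalIdeal R).map (algebraMap R S) ≠ ⊤ := by
    intro h
    have h1 : (IsLocalRing.maximalIdeal R).map (algebraMap R S) ≤ IsLocalRing.maximalIdeal S :=
      ((IsLocalRing.local_hom_TFAE (algebraMap R S)).out 0 2).1 ‹IsLocalHom _›
    rw [h, top_le_iff] at h1
    exact (IsLocalRing.maximalIdeal.isMaximal S).ne_top h1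
  have : Nontrivial (ClosedFiber R S) := Ideal.Quotient.nontrivial_iff.2 h
  exact IsLocalRing.of_surjective'
    (Ideal.Quotient.mk ((IsLocalRing.maximalIdeal R).map (algebraMap R S)))
    Ideal.Quotient.mk_surjective

end ClosedFiber

end PhantomDepth

/-!
Both sides of the formula are detected by socles, and a socle element of `S ⊗ M` modulo `φ(as), zs`
is produced from one of `M` modulo `as` and one of the closed fiber modulo `zs`.

*Phantom depth.* Say that `N` has a phantom socle element if some `g ∈ F^e(N)` lies outside the
tight closure of `0` while `𝔪 g` lies inside it (`HasPhantomSocle`). If a phantom `M`-regular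
sequence `xs` is such that `M / xs M` has a phantom socle element, then `xs` is maximal and has the
largest length possible (`IsPhantomRegularSeq.length_le_of_hasPhantomSocle`). To see this, a weak
test element `c` is used to linearize the problem. On the product of all `F^e(M)`, where `r ∈ R`
acts on `F^e(M)` through `r ^ p ^ e`, let `X` act as the shift `(z_e) ↦ (c F(z_{e-1}))`. Inverting
`X` kills exactly the sequences with all members in the tight closure of `0`. The resulting
`R[X]`-module `FrobLim` is a functor of `M` that is right exact on `M → M → M / xM → 0`, and turns
phantom regular elements into regular elements and phantom socle elements into elements killed by
`𝔪`. So the usual argument with `Ext (R[X] / 𝔪R[X]) (FrobLim M)` applies. Conversely, avoidance for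
`M` gives a phantom socle element modulo each maximal phantom regular sequence
(`IsMaximalPhantomRegularSeq.hasPhantomSocle`). Avoidance is needed over `R` only.

*Base change of regularity.* By flatness `S ⊗ F^e_R(M) ≃ F^e_S(S ⊗ M)`, so phantom regular elements
in `𝔪` stay phantom regular over `S`. A sequence that is regular on the closed fiber is regular on
`S ⊗ L` for each finitely generated `R`-module `L` (`isWeaklyRegular_tensor`); applied to its
`p ^ e`-th powers and `L = F^e(M)` this makes it phantom regular on `S ⊗ M`. Together, `φ(as), zs`
is a phantom regular sequence (`IsPhantomRegularSeq.baseChange_append`).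

*Base change of socles.* Let `u ∈ F^e(N)` be a phantom socle element, and let `w ∈ S` represent a
socle element of the closed fiber modulo `zs ^ p ^ e`, where `zs` is a system of parameters of the
closed fiber because the latter is Cohen-Macaulay. Then the maximal ideal of `S` multiplies the
class of `w u` into the tight closure of `0`. If the class itself were in the tight closure of `0`,
then `w ^ p ^ k ⊗ c F^k(u)` would vanish modulo `zs ^ p ^ (e + k)` for all large `k`. By
`F`-injectivity `w ^ p ^ k` is nonzero in the closed fiber modulo these powers, so flatness forces
`c F^k(u) = 0` (`eq_zero_of_tmul_mem_ofList_smul_top`) and `u` would be in the tight closure of `0`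
(`HasPhantomSocle.baseChange_append`).
-/

/-! ### Frobenius powers and their functoriality -/

namespace PhantomDepth

section

open scoped Pointwise

section Frobenius

variable {R : Type u} [CommRing R] {p : ℕ} [Fact p.Prime] [CharP R p]

theorem FrobPow.induction {e : ℕ} {M : Type v} [AddCommGroup M] [Module R M]
    {P : FrobPow R p e M → Prop} (h : ∀ (r : R) (m : M), P (r • frobElt R p e m))
    (hadd : ∀ v w, P v → P w → P (v + w)) (v : FrobPow R p e M) : P v := by
  refine TensorProduct.induction_on (motive := P) v ?_ ?_ hadd
  · have := h 0 0
    rwa [zero_smul] at this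
  · intro a m
    have h1 (a : R) : TensorProduct.tmul R (M := FrobRing R p e) a m = a • frobElt R p e m := by
      refine Eq.trans ?_ (TensorProduct.smul_tmul' (R := R) (show FrobRing R p e from a)
        (1 : FrobRing R p e) m).symm
      rw [smul_eq_mul, mul_one]
    exact (h1 a).symm ▸ h a m

theorem FrobPow.hom_ext {A : Type*} [CommRing A] {σ : R →+* A} {e : ℕ}
    {M : Type v} [AddCommGroup M] [Module R M] {L : Type w} [AddCommGroup L] [Module A L]
    {f g : FrobPow R p e M →ₛₗ[σ] L}
    (h : ∀ m, f (frobElt R p e m) = g (frobElt R p e m)) : f = g := by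
  ext v
  induction v using FrobPow.induction with
  | h r m => rw [map_smulₛₗ, map_smulₛₗ, h]
  | hadd v w hv hw => rw [map_add, map_add, hv, hw]

/-- The additive map underlying `frobLift`. -/
noncomputable def frobLiftAux {A : Type*} [CommRing A] (σ : R →+* A) (e : ℕ)
    {M : Type v} [AddCommGroup M] [Module R M] {L : Type w} [AddCommGroup L] [Module A L]
    (g : M →+ L) (hg : ∀ (r : R) m, g (r • m) = σ (r ^ p ^ e) • g m) :
    FrobPow R p e M →+ L :=
  TensorProduct.liftAddHom (M := FrobRing R p e) (R := R)
    { toFun := fun a => (DistribSMul.toAddMonoidHom L (σ a)).comp g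
      map_zero' := by ext; simp [show σ (0 : FrobRing R p e) = 0 from map_zero σ]
      map_add' := fun a b => by
        ext m
        simp [show σ (a + b : FrobRing R p e) = σ a + σ b from map_add σ a b, add_smul] }
    (fun r a m => by
      change σ (r ^ p ^ e * (show R from a) : R) • g m = σ a • g (r • m)
      rw [hg, map_mul, mul_comm, mul_smul])

theorem frobLiftAux_smul_frobElt {A : Type*} [CommRing A] (σ : R →+* A) (e : ℕ)
    {M : Type v} [AddCommGroup M] [Module R M] {L : Type w} [AddCommGroup L] [Module A L]
    (g : M →+ L) (hg : ∀ (r : R) m, g (r • m) = σ (r ^ p ^ e) • g m) (r : R) (m : M) :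
    frobLiftAux σ e g hg (r • frobElt R p e m) = σ r • g m := by
  change σ (r * (1 : R)) • g m = σ r • g m
  rw [mul_one]

/-- The universal property of `F^e(M)`: an additive map `g : M → L` that is semilinear over
`r ↦ σ (r ^ p ^ e)` extends to a `σ`-semilinear map sending `z ^ p ^ e` to `g z`. -/
noncomputable def frobLift {A : Type*} [CommRing A] (σ : R →+* A) (e : ℕ)
    {M : Type v} [AddCommGroup M] [Module R M] {L : Type w} [AddCommGroup L] [Module A L]
    (g : M →+ L) (hg : ∀ (r : R) m, g (r • m) = σ (r ^ p ^ e) • g m) :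
    FrobPow R p e M →ₛₗ[σ] L where
  toFun := frobLiftAux σ e g hg
  map_add' := map_add _
  map_smul' := by
    intro r v
    induction v using FrobPow.induction with
    | h s m =>
      rw [smul_smul, frobLiftAux_smul_frobElt, frobLiftAux_smul_frobElt, map_mul, mul_smul]
    | hadd v w hv hw => rw [smul_add, map_add, map_add, hv, hw, smul_add]

@[simp]
theorem frobLift_frobElt {A : Type*} [CommRing A] (σ : R →+* A) (e : ℕ)
    {M : Type v} [AddCommGroup M] [Module R M] {L : Type w} [AddCommGroup L] [Module A L]
    (g : M →+ L) (hg : ∀ (r : R) m, g (r • m) = σ (r ^ p ^ e) • g m) (m : M) :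
    frobLift σ e g hg (frobElt R p e m) = g m := by
  have := frobLiftAux_smul_frobElt σ e g hg 1 m
  rwa [one_smul, map_one, one_smul] at this

variable (R p) in
/-- `frobElt` as an additive map. -/
noncomputable def frobEltHom (e : ℕ) (M : Type v) [AddCommGroup M] [Module R M] :
    M →+ FrobPow R p e M where
  toFun := frobElt R p e
  map_zero' := frobElt_zero
  map_add' := frobElt_add

@[simp]
theorem frobEltHom_apply {e : ℕ} {M : Type v} [AddCommGroup M] [Module R M] (m : M) :
    frobEltHom R p e M m = frobElt R p e m := rfl

variable (R p) in
/-- The `k`-fold Frobenius action `F^e(M) → F^{e+k}(M)`, `a ⊗ m ↦ a ^ p ^ k ⊗ m`. Under the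
identification of `F^k(F^e(M))` with `F^{e+k}(M)` it sends `v` to `v ^ p ^ k`. -/
noncomputable def frobPush (e k : ℕ) (M : Type v) [AddCommGroup M] [Module R M] :
    FrobPow R p e M →ₛₗ[iterateFrobenius R p k] FrobPow R p (e + k) M :=
  frobLift _ e (frobEltHom R p (e + k) M) fun r m => by
    simp only [frobEltHom_apply, frobElt_smul, iterateFrobenius_def, ← pow_mul, pow_add]

section

variable {e k : ℕ} {M : Type v} [AddCommGroup M] [Module R M]
  {N : Type w} [AddCommGroup N] [Module R N]

@[simp]
theorem frobPush_frobElt (m : M) :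
    frobPush R p e k M (frobElt R p e m) = frobElt R p (e + k) m := by
  simp [frobPush]

theorem frobPush_smul (r : R) (v : FrobPow R p e M) :
    frobPush R p e k M (r • v) = r ^ p ^ k • frobPush R p e k M v := by
  rw [map_smulₛₗ, iterateFrobenius_def]

theorem frobPush_succ (v : FrobPow R p e M) :
    frobPush R p e (k + 1) M v = frobPush R p (e + k) 1 M (frobPush R p e k M v) := by
  induction v using FrobPow.induction with
  | h r m =>
    simp only [frobPush_smul, frobPush_frobElt, ← pow_mul, pow_one, pow_succ p k]
    rfl
  | hadd v w hv hw => simp only [map_add, hv, hw]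

theorem frobPush_zero (v : FrobPow R p e M) : frobPush R p e 0 M v = v := by
  induction v using FrobPow.induction with
  | h r m => simp only [frobPush_smul, frobPush_frobElt, pow_zero, pow_one]; rfl
  | hadd v w hv hw => simp only [map_add, hv, hw]

@[simp]
theorem frobMap_frobElt (f : M →ₗ[R] N) (m : M) :
    frobMap R p e f (frobElt R p e m) = frobElt R p e (f m) := rfl

theorem frobMap_frobPush (f : M →ₗ[R] N) (v : FrobPow R p e M) :
    frobMap R p (e + k) f (frobPush R p e k M v) = frobPush R p e k N (frobMap R p e f v) := by
  induction v using FrobPow.induction with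
  | h r m => simp only [frobPush_smul, map_smul, frobPush_frobElt, frobMap_frobElt]
  | hadd v w hv hw => simp only [map_add, hv, hw]

theorem frobMap_surjective {f : M →ₗ[R] N} (hf : Function.Surjective f) :
    Function.Surjective (frobMap R p e f) := by
  intro v
  induction v using FrobPow.induction with
  | h r n =>
    obtain ⟨m, rfl⟩ := hf n
    exact ⟨r • frobElt R p e m, by rw [map_smul, frobMap_frobElt]⟩
  | hadd v w hv hw =>
    obtain ⟨a, rfl⟩ := hv
    obtain ⟨b, rfl⟩ := hw
    exact ⟨a + b, map_add _ _ _⟩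

variable (R p e) in
/-- The isomorphism `F^e(M) ≃ F^e(N)` induced by an isomorphism `M ≃ N`. -/
noncomputable def frobCongr (f : M ≃ₗ[R] N) : FrobPow R p e M ≃ₗ[R] FrobPow R p e N :=
  LinearEquiv.ofLinearMap (frobMap R p e f.toLinearMap) (frobMap R p e f.symm.toLinearMap)
    (FrobPow.hom_ext fun m => by simp) (FrobPow.hom_ext fun m => by simp)

theorem frobCongr_apply (f : M ≃ₗ[R] N) (v : FrobPow R p e M) :
    frobCongr R p e f v = frobMap R p e f.toLinearMap v := rfl

/-- Right exactness of the Frobenius power for a quotient `M → M / K`. -/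
theorem ker_frobMap_mkQ (K : Submodule R M) :
    LinearMap.ker (frobMap R p e K.mkQ) = Submodule.span R (frobElt R p e '' (K : Set M)) := by
  set W := Submodule.span R (frobElt R p e '' (K : Set M))
  apply le_antisymm
  · -- a one-sided inverse of `F^e(M) / W → F^e(M / K)` shows that its kernel is trivial
    let g : M →+ FrobPow R p e M ⧸ W := W.mkQ.toAddMonoidHom.comp (frobEltHom R p e M)
    have hg : ∀ m ∈ K, g m = 0 := fun m hm =>
      (Submodule.Quotient.mk_eq_zero W).2 (Submodule.subset_span ⟨m, hm, rfl⟩)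
    have hs : ∀ (r : R) m, g (r • m) = (RingHom.id R) (r ^ p ^ e) • g m := fun r m => by
      simp [g, frobElt_smul]
    let g' : (M ⧸ K) →+ FrobPow R p e M ⧸ W := QuotientAddGroup.lift K.toAddSubgroup g hg
    let l := frobLift (p := p) (RingHom.id R) e g' (by
      intro r m
      obtain ⟨m, rfl⟩ := K.mkQ_surjective m
      exact hs r m)
    have hl : l ∘ₗ frobMap R p e K.mkQ = W.mkQ := by
      refine FrobPow.hom_ext fun m => ?_
      simp only [LinearMap.comp_apply, frobMap_frobElt, l, frobLift_frobElt]
      rfl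
    intro v hv
    have := LinearMap.congr_fun hl v
    rw [LinearMap.comp_apply, LinearMap.mem_ker.1 hv, map_zero] at this
    exact (Submodule.Quotient.mk_eq_zero W).1 this.symm
  · refine Submodule.span_le.2 ?_
    rintro _ ⟨m, hm, rfl⟩
    simp only [SetLike.mem_coe, LinearMap.mem_ker, frobMap_frobElt, Submodule.mkQ_apply,
      (Submodule.Quotient.mk_eq_zero K).2 hm, frobElt_zero]

theorem span_range_frobElt :
    Submodule.span R (Set.range (frobElt R p e (M := M))) = ⊤ := by
  refine Submodule.eq_top_iff'.2 fun v => ?_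
  induction v using FrobPow.induction with
  | h r m => exact Submodule.smul_mem _ _ (Submodule.subset_span ⟨m, rfl⟩)
  | hadd v w hv hw => exact Submodule.add_mem _ hv hw

/-- `F^e(M / (x₁, …, xₙ)M)` is `F^e(M)` modulo the `p ^ e`-th powers of the `xᵢ`. -/
theorem ker_frobMap_mkQ_ofList (xs : List R) :
    LinearMap.ker (frobMap R p e (Ideal.ofList xs • ⊤ : Submodule R M).mkQ) =
      Ideal.ofList (xs.map (· ^ p ^ e)) • ⊤ := by
  rw [ker_frobMap_mkQ]
  apply le_antisymm
  · refine Submodule.span_le.2 ?_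
    rintro _ ⟨m, hm, rfl⟩
    refine Submodule.smul_induction_on (p := fun m => frobElt R p e m ∈ _) hm ?_ ?_
    · intro r hr n _
      rw [frobElt_smul]
      refine Submodule.smul_mem_smul ?_ Submodule.mem_top
      have := Ideal.mem_map_of_mem (iterateFrobenius R p e) hr
      rw [Ideal.map_ofList] at this
      exact this
    · intro a b ha hb
      rw [frobElt_add]
      exact Submodule.add_mem _ ha hb
  · rw [← span_range_frobElt, Ideal.ofList, Submodule.span_smul_span]
    refine Submodule.span_mono ?_
    rintro _ ⟨y, hy, _, ⟨m, rfl⟩, rfl⟩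
    obtain ⟨x, hx, rfl⟩ := List.mem_map.1 hy
    exact ⟨x • m, Submodule.smul_mem_smul (Ideal.subset_span hx) Submodule.mem_top,
      frobElt_smul x m⟩

theorem ker_frobMap_mkQ_smul (x : R) :
    LinearMap.ker (frobMap R p e (Submodule.mkQ (x • (⊤ : Submodule R M)))) =
      x ^ p ^ e • (⊤ : Submodule R (FrobPow R p e M)) := by
  have h := ker_frobMap_mkQ_ofList (p := p) (e := e) (M := M) [x]
  rw [List.map_singleton, Ideal.ofList_singleton, Ideal.ofList_singleton,
    Submodule.ideal_span_singleton_smul, Submodule.ideal_span_singleton_smul] at h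
  exact h

instance FrobPow.finite [Module.Finite R M] : Module.Finite R (FrobPow R p e M) :=
  inferInstanceAs (Module.Finite (FrobRing R p e) (FrobRing R p e ⊗[R] M))

/-- `F^k(F^e(M))` is `F^{e+k}(M)`, so vanishing can be tested there. -/
theorem smul_frobElt_frobPow_eq_zero_iff (c : R) (v : FrobPow R p e M) :
    c • frobElt R p k v = 0 ↔ c • frobPush R p e k M v = 0 := by
  let ρ : FrobPow R p k (FrobPow R p e M) →ₗ[R] FrobPow R p (e + k) M :=
    frobLift (RingHom.id R) k (frobPush R p e k M).toAddMonoidHom fun r m => frobPush_smul r m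
  let τ : FrobPow R p (e + k) M →ₗ[R] FrobPow R p k (FrobPow R p e M) :=
    frobLift (RingHom.id R) (e + k)
      ((frobEltHom R p k (FrobPow R p e M)).comp (frobEltHom R p e M)) fun r m => by
        simp [frobElt_smul, ← pow_mul, pow_add]
  have hρ : ∀ v, ρ (frobElt R p k v) = frobPush R p e k M v := fun v => by
    exact frobLift_frobElt (p := p) (RingHom.id R) k (frobPush R p e k M).toAddMonoidHom _ v
  have hτ : ∀ v, τ (frobPush R p e k M v) = frobElt R p k v := fun v => by
    induction v using FrobPow.induction with
    | h r m =>
      rw [frobPush_smul, frobPush_frobElt, map_smul, frobElt_smul]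
      simp [τ]
    | hadd v w hv hw => simp only [map_add, frobElt_add, hv, hw]
  constructor <;> intro h
  · rw [← hρ, ← map_smul, h, map_zero]
  · rw [← hτ, ← map_smul, h, map_zero]

theorem frobSubmodule_bot : frobSubmodule R p e (⊥ : Submodule R M) = ⊥ := by
  rw [frobSubmodule, LinearMap.range_eq_bot]
  refine FrobPow.hom_ext fun m => ?_
  simp [show m = 0 from Subsingleton.elim _ _, frobElt_zero]

/-- By `F^k(F^e(M)) ≃ F^{e+k}(M)`, membership in the tight closure of `0` in `F^e(M)` can be tested
with the Frobenius actions on the Frobenius powers of `M` itself. -/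
theorem mem_tightClosure_bot_iff (v : FrobPow R p e M) :
    v ∈ tightClosure R p (⊥ : Submodule R (FrobPow R p e M)) ↔
      ∃ c ∈ minPrimesCompl R, ∃ e₀ : ℕ, ∀ k ≥ e₀, c • frobPush R p e k M v = 0 := by
  change (∃ c ∈ minPrimesCompl R, ∃ e₀ : ℕ, ∀ k ≥ e₀, c • frobElt R p k v ∈ _) ↔ _
  simp only [frobSubmodule_bot, Submodule.mem_bot, smul_frobElt_frobPow_eq_zero_iff]

end

theorem IsWeakTestElement.smul_frobPush_eq_zero {e₀ : ℕ} {c : R}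
    (hc : IsWeakTestElement R p e₀ c) {M : Type u} [AddCommGroup M] [Module R M]
    [Module.Finite R M] {e : ℕ} {v : FrobPow R p e M}
    (hv : v ∈ tightClosure R p (⊥ : Submodule R (FrobPow R p e M))) {k : ℕ} (hk : e₀ ≤ k) :
    c • frobPush R p e k M v = 0 := by
  have := hc.2 (FrobPow R p e M) ⊥ v hv k hk
  rwa [frobSubmodule_bot, Submodule.mem_bot, smul_frobElt_frobPow_eq_zero_iff] at this

theorem map_mem_tightClosure_bot {e : ℕ} {M : Type v} [AddCommGroup M] [Module R M]
    {N : Type w} [AddCommGroup N] [Module R N] (f : M →ₗ[R] N) {v : FrobPow R p e M}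
    (hv : v ∈ tightClosure R p (⊥ : Submodule R (FrobPow R p e M))) :
    frobMap R p e f v ∈ tightClosure R p (⊥ : Submodule R (FrobPow R p e N)) := by
  rw [mem_tightClosure_bot_iff] at hv ⊢
  obtain ⟨c, hc, e₀, h⟩ := hv
  refine ⟨c, hc, e₀, fun k hk => ?_⟩
  rw [← frobMap_frobPush, ← map_smul, h k hk, map_zero]

theorem frobCongr_mem_tightClosure_bot_iff {e : ℕ} {M : Type v} [AddCommGroup M] [Module R M]
    {N : Type w} [AddCommGroup N] [Module R N] (f : M ≃ₗ[R] N) {v : FrobPow R p e M} :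
    frobCongr R p e f v ∈ tightClosure R p (⊥ : Submodule R (FrobPow R p e N)) ↔
      v ∈ tightClosure R p (⊥ : Submodule R (FrobPow R p e M)) := by
  refine ⟨fun h => ?_, map_mem_tightClosure_bot f.toLinearMap⟩
  have := map_mem_tightClosure_bot f.symm.toLinearMap h
  rwa [← frobCongr_apply, show frobCongr R p e f.symm = (frobCongr R p e f).symm from rfl,
    LinearEquiv.symm_apply_apply] at this

end Frobenius

end

end PhantomDepth

/-! ### The localized product of the Frobenius powers -/

namespace PhantomDepth

section

open Polynomial (X C)
open scoped Polynomial
open scoped Pointwise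

section Sequences

variable {R : Type u} [CommRing R] {p : ℕ} [Fact p.Prime] [CharP R p]

variable (R p) in
/-- The product of all Frobenius powers of `M`, with `r : R` acting on the factor `F^e(M)` as
multiplication by `r ^ p ^ e`, so that the action commutes with Frobenius. -/
def FrobProd (M : Type v) [AddCommGroup M] [Module R M] : Type (max u v) :=
  ∀ e : ℕ, FrobPow R p e M

noncomputable instance (M : Type v) [AddCommGroup M] [Module R M] :
    AddCommGroup (FrobProd R p M) :=
  inferInstanceAs (AddCommGroup (∀ e : ℕ, FrobPow R p e M))

noncomputable instance (M : Type v) [AddCommGroup M] [Module R M] :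
    Module R (FrobProd R p M) where
  smul r z := fun e => r ^ p ^ e • z e
  one_smul z := funext fun e => by
    change (1 : R) ^ p ^ e • z e = z e
    rw [one_pow, one_smul]
  mul_smul r s z := funext fun e => by
    change (r * s) ^ p ^ e • z e = r ^ p ^ e • s ^ p ^ e • z e
    rw [mul_pow, mul_smul]
  smul_zero r := funext fun e => smul_zero (r ^ p ^ e)
  smul_add r y z := funext fun e => smul_add (r ^ p ^ e) (y e) (z e)
  add_smul r s z := funext fun e => by
    change (r + s) ^ p ^ e • z e = r ^ p ^ e • z e + s ^ p ^ e • z e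
    rw [add_pow_char_pow, add_smul]
  zero_smul z := funext fun e => by
    change (0 : R) ^ p ^ e • z e = 0
    rw [zero_pow (pow_ne_zero _ (Fact.out : p.Prime).ne_zero), zero_smul]

section

variable {M : Type v} [AddCommGroup M] [Module R M] {N : Type w} [AddCommGroup N] [Module R N]

theorem FrobProd.smul_apply (r : R) (z : FrobProd R p M) (e : ℕ) :
    (r • z) e = r ^ p ^ e • z e := rfl

variable (p M) in
/-- The shift `(z_e) ↦ (c F(z_{e-1}))`, with `0` in degree `0`. -/
noncomputable def frobShift (c : R) : FrobProd R p M →ₗ[R] FrobProd R p M where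
  toFun z
    | 0 => 0
    | e + 1 => c • frobPush R p e 1 M (z e)
  map_add' y z := funext fun e => by
    cases e with
    | zero => exact (add_zero _).symm
    | succ e =>
      change c • frobPush R p e 1 M (y e + z e) = c • _ + c • _
      rw [map_add, smul_add]
  map_smul' r z := funext fun e => by
    cases e with
    | zero => exact (smul_zero (r ^ p ^ 0)).symm
    | succ e =>
      change c • frobPush R p e 1 M (r ^ p ^ e • z e) =
        r ^ p ^ (e + 1) • c • frobPush R p e 1 M (z e)
      rw [frobPush_smul, smul_comm, ← pow_mul, pow_one, pow_succ]

/-- The `k`-th power of the shift is the `k`-fold Frobenius action up to a power of `c`, whose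
exponent is positive as soon as `k` is. -/
theorem frobShift_pow_add (c : R) (k : ℕ) (z : FrobProd R p M) (e : ℕ) :
    ∃ n : ℕ, (0 < k → 0 < n) ∧
      ((frobShift p M c ^ k) z) (e + k) = c ^ n • frobPush R p e k M (z e) := by
  induction k with
  | zero => exact ⟨0, id, by rw [pow_zero, pow_zero, one_smul, frobPush_zero]; rfl⟩
  | succ k ih =>
    obtain ⟨n, -, hn⟩ := ih
    refine ⟨1 + n * p, fun _ => by omega, ?_⟩
    rw [pow_succ', Module.End.mul_apply]
    change c • frobPush R p (e + k) 1 M (((frobShift p M c ^ k) z) (e + k)) = _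
    rw [hn, frobPush_smul, frobPush_succ (k := k), smul_smul, pow_add, pow_one, pow_one, pow_mul]

theorem frobShift_pow_of_lt (c : R) {k : ℕ} (z : FrobProd R p M) {i : ℕ} (hi : i < k) :
    ((frobShift p M c ^ k) z) i = 0 := by
  induction k generalizing i with
  | zero => omega
  | succ k ih =>
    rw [pow_succ', Module.End.mul_apply]
    cases i with
    | zero => rfl
    | succ i =>
      change c • frobPush R p i 1 M (((frobShift p M c ^ k) z) i) = 0
      rw [ih (by omega), map_zero, smul_zero]

/-- If `c` and `e₀` uniformly witness that the members of `z` lie in the tight closures of `0`,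
then a power of the shift kills `z`. -/
theorem frobShift_pow_eq_zero {c : R} {e₀ : ℕ} {z : FrobProd R p M}
    (hz : ∀ e, ∀ k ≥ e₀, c • frobPush R p e k M (z e) = 0) :
    (frobShift p M c ^ (e₀ + 1)) z = 0 := by
  funext i
  rcases lt_or_ge i (e₀ + 1) with hi | hi
  · exact frobShift_pow_of_lt c z hi
  · obtain ⟨e, rfl⟩ := Nat.exists_eq_add_of_le' hi
    obtain ⟨n, hn, h⟩ := frobShift_pow_add c (e₀ + 1) z e
    rw [h]
    obtain ⟨n, rfl⟩ := Nat.exists_eq_succ_of_ne_zero (hn (by omega)).ne'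
    rw [pow_succ, mul_smul, hz e _ (by omega), smul_zero]
    rfl

variable (p) in
/-- The map of products induced by a linear map. -/
noncomputable def frobProdMap (f : M →ₗ[R] N) : FrobProd R p M →ₗ[R] FrobProd R p N where
  toFun z e := frobMap R p e f (z e)
  map_add' _ _ := funext fun _ => map_add _ _ _
  map_smul' r z := funext fun e => map_smul (frobMap R p e f) (r ^ p ^ e) (z e)

theorem frobProdMap_frobShift (c : R) (f : M →ₗ[R] N) (z : FrobProd R p M) :
    frobProdMap p f (frobShift p M c z) = frobShift p N c (frobProdMap p f z) := by
  funext e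
  cases e with
  | zero => exact map_zero (frobMap R p 0 f)
  | succ e =>
    change frobMap R p (e + 1) f (c • frobPush R p e 1 M (z e)) =
      c • frobPush R p e 1 N (frobMap R p e f (z e))
    rw [map_smul, frobMap_frobPush]

variable (p M) in
/-- The product of the Frobenius powers of `M` as a module over `R[X]`, where `X` acts as the
shift `(z_e) ↦ (c F(z_{e-1}))`. -/
abbrev FrobSeq (c : R) : Type (max u v) := Module.AEval' (frobShift p M c)

variable (p M) in
/-- The module `FrobSeq` with the action of `X` inverted. When `c` is a weak test element, this
kills exactly the sequences all of whose members lie in the tight closure of `0`, so that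
`M ↦ FrobLim p M c` turns phantom regular elements into regular ones. -/
abbrev FrobLim (c : R) : Type (max u v) :=
  LocalizedModule (Submonoid.powers (X : R[X])) (FrobSeq p M c)

variable (p) in
/-- Functoriality of `FrobSeq`. -/
noncomputable def frobSeqMap (c : R) (f : M →ₗ[R] N) : FrobSeq p M c →ₗ[R[X]] FrobSeq p N c :=
  LinearMap.ofAEval _ ((Module.AEval'.of (frobShift p N c)).toLinearMap ∘ₗ frobProdMap p f)
    fun z => by
      change Module.AEval'.of _ (frobProdMap p f (frobShift p M c z)) = _
      rw [frobProdMap_frobShift]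
      exact (Module.AEval.X_smul_of _ _).symm

variable (p) in
/-- Functoriality of `FrobLim`. -/
noncomputable def frobLimMap (c : R) (f : M →ₗ[R] N) : FrobLim p M c →ₗ[R[X]] FrobLim p N c :=
  (LocalizedModule.map (Submonoid.powers (X : R[X])) (frobSeqMap p c f)).restrictScalars R[X]

/-- Right exactness of `FrobLim` along multiplication by `x`. It holds because the kernel of
`F^e(M) → F^e(M / xM)` is the image of `x ^ p ^ e`, which is how `x` acts on the factor `F^e(M)`. -/
theorem exact_frobLimMap (c x : R) (M : Type v) [AddCommGroup M] [Module R M] :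
    Function.Exact (LinearMap.lsmul R[X] (FrobLim p M c) (C x))
      (frobLimMap p c (x • (⊤ : Submodule R M)).mkQ) := by
  have h : Function.Exact (LinearMap.lsmul R[X] (FrobSeq p M c) (C x))
      (frobSeqMap p c (x • (⊤ : Submodule R M)).mkQ) := by
    intro y
    have hy (y : FrobProd R p M) (e : ℕ) :
        frobMap R p e (Submodule.mkQ (x • (⊤ : Submodule R M))) (y e) = 0 ↔
          ∃ w, x ^ p ^ e • w = y e := by
      rw [← LinearMap.mem_ker, ker_frobMap_mkQ_smul, Submodule.mem_smul_pointwise_iff_exists]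
      simp
    constructor
    · intro h
      choose z hz using fun e => (hy y e).1 (congrFun h e)
      refine ⟨Module.AEval'.of _ z, ?_⟩
      rw [LinearMap.lsmul_apply, Module.AEval.C_smul]
      exact funext hz
    · rintro ⟨z, rfl⟩
      rw [LinearMap.lsmul_apply, map_smul, Module.AEval.C_smul]
      funext e
      change x ^ p ^ e • frobMap R p e (x • (⊤ : Submodule R M)).mkQ (z e) = 0
      rw [← map_smul]
      exact (hy (fun e => x ^ p ^ e • z e) e).2 ⟨z e, rfl⟩
  have hC (t : FrobLim p M c) : LocalizedModule.map (Submonoid.powers (X : R[X]))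
      (LinearMap.lsmul R[X] (FrobSeq p M c) (C x)) t = C x • t := by
    induction t using LocalizedModule.induction_on with
    | _ m s => rw [LocalizedModule.map_mk, LinearMap.lsmul_apply, LocalizedModule.smul'_mk]
  intro y
  refine (LocalizedModule.map_exact (Submonoid.powers (X : R[X])) _ _ h y).trans ?_
  exact exists_congr fun t => ⟨fun h => (hC t).symm.trans h, fun h => (hC t).trans h⟩

theorem frobLimMap_surjective (c : R) {f : M →ₗ[R] N} (hf : Function.Surjective f) :
    Function.Surjective (frobLimMap p c f) := by
  have h : Function.Surjective (frobSeqMap p c f) := by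
    intro y
    choose z hz using fun e => frobMap_surjective (p := p) (e := e) hf (y e)
    exact ⟨Module.AEval'.of _ z, funext hz⟩
  exact LocalizedModule.map_surjective _ _ h

variable (p) in
/-- The image in `FrobLim` of a sequence. -/
noncomputable def frobLimMk (c : R) : FrobProd R p M →+ FrobLim p M c :=
  (LocalizedModule.mkLinearMap (Submonoid.powers (X : R[X])) (FrobSeq p M c)).toAddMonoidHom.comp
    (Module.AEval'.of (frobShift p M c)).toAddMonoidHom

/-- Since `X` is inverted, a sequence vanishes in `FrobLim` exactly if a power of the shift kills
it. -/
theorem frobLimMk_eq_zero_iff {c : R} {z : FrobProd R p M} :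
    frobLimMk p c z = 0 ↔ ∃ k : ℕ, (frobShift p M c ^ k) z = 0 := by
  refine (IsLocalizedModule.eq_zero_iff (Submonoid.powers (X : R[X]))
    (LocalizedModule.mkLinearMap (Submonoid.powers (X : R[X])) (FrobSeq p M c))).trans ?_
  constructor
  · rintro ⟨⟨_, k, rfl⟩, h⟩
    exact ⟨k, (Module.AEval.X_pow_smul_of (frobShift p M c) z k).symm.trans h⟩
  · rintro ⟨k, h⟩
    exact ⟨⟨X ^ k, k, rfl⟩, (Module.AEval.X_pow_smul_of (frobShift p M c) z k).trans h⟩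

theorem C_smul_frobLimMk (c r : R) (z : FrobProd R p M) :
    (C r : R[X]) • frobLimMk p c z = frobLimMk p c (r • z) := by
  refine (map_smul (LocalizedModule.mkLinearMap (Submonoid.powers (X : R[X]))
    (FrobSeq p M c)) _ _).symm.trans ?_
  exact congrArg _ (Module.AEval.C_smul _ r _)

/-- Every element of `FrobLim` becomes a sequence after multiplication by a power of `X`. -/
theorem exists_X_pow_smul_eq_frobLimMk (c : R) (t : FrobLim p M c) :
    ∃ (k : ℕ) (z : FrobProd R p M), (X ^ k : R[X]) • t = frobLimMk p c z := by
  obtain ⟨⟨z, ⟨_, k, rfl⟩⟩, h⟩ := IsLocalizedModule.surj (Submonoid.powers (X : R[X]))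
    (LocalizedModule.mkLinearMap (Submonoid.powers (X : R[X])) (FrobSeq p M c)) t
  exact ⟨k, z, h⟩

theorem eq_zero_of_X_pow_smul_eq_zero {c : R} {t : FrobLim p M c} {k : ℕ}
    (h : (X ^ k : R[X]) • t = 0) : t = 0 :=
  IsLocalizedModule.smul_injective
    (LocalizedModule.mkLinearMap (Submonoid.powers (X : R[X])) (FrobSeq p M c))
    (⟨X ^ k, k, rfl⟩ : Submonoid.powers (X : R[X])) (h.trans (smul_zero _).symm)

open Classical in
variable (p) in
/-- The sequence `(F^k(g))` of Frobenius iterates of `g ∈ F^e(M)`, extended by `0` to degrees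
below `e`. -/
noncomputable def frobOrbit (e : ℕ) (g : FrobPow R p e M) : FrobProd R p M := fun i =>
  if h : e ≤ i then Nat.add_sub_of_le h ▸ frobPush R p e (i - e) M g else 0

theorem frobOrbit_of_lt {e i : ℕ} (g : FrobPow R p e M) (h : i < e) :
    frobOrbit p e g i = 0 := dif_neg h.not_ge

theorem frobOrbit_add (e k : ℕ) (g : FrobPow R p e M) :
    frobOrbit p e g (e + k) = frobPush R p e k M g := by
  have : ∀ (j : ℕ) (h : e + j = e + k), h ▸ frobPush R p e j M g = frobPush R p e k M g := by
    intro j h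
    obtain rfl : j = k := Nat.add_left_cancel h
    rfl
  exact (dif_pos (Nat.le_add_right e k)).trans (this _ _)

theorem frobShift_pow_frobOrbit_of_lt (c : R) (k : ℕ) {e : ℕ} (g : FrobPow R p e M) {i : ℕ}
    (hi : i < e + k) : ((frobShift p M c ^ k) (frobOrbit p e g)) i = 0 := by
  induction k generalizing i with
  | zero => exact frobOrbit_of_lt g hi
  | succ k ih =>
    rw [pow_succ', Module.End.mul_apply]
    cases i with
    | zero => rfl
    | succ i =>
      change c • frobPush R p i 1 M (((frobShift p M c ^ k) (frobOrbit p e g)) i) = 0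
      rw [ih (by omega), map_zero, smul_zero]

theorem frobShift_pow_frobOrbit (c : R) (k : ℕ) :
    ∃ n : ℕ, (0 < k → 0 < n) ∧ ∀ (e : ℕ) (g : FrobPow R p e M), ∀ j ≥ k,
      ((frobShift p M c ^ k) (frobOrbit p e g)) (e + j) = c ^ n • frobPush R p e j M g := by
  induction k with
  | zero =>
    refine ⟨0, id, fun e g j _ => ?_⟩
    rw [pow_zero, pow_zero, one_smul, ← frobOrbit_add]
    rfl
  | succ k ih =>
    obtain ⟨n, -, hn⟩ := ih
    refine ⟨1 + n * p, fun _ => by omega, fun e g j hj => ?_⟩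
    obtain ⟨j, rfl⟩ := Nat.exists_eq_succ_of_ne_zero (n := j) (by omega)
    rw [pow_succ', Module.End.mul_apply]
    change c • frobPush R p (e + j) 1 M (((frobShift p M c ^ k) (frobOrbit p e g)) (e + j)) = _
    rw [hn e g j (by omega), frobPush_smul, smul_smul, pow_one, ← pow_mul, ← pow_succ']
    rw [add_comm 1 (n * p)]
    exact congrArg _ (frobPush_succ g).symm

theorem pow_mem_minPrimesCompl {c : R} (hc : c ∈ minPrimesCompl R) (n : ℕ) :
    c ^ n ∈ minPrimesCompl R :=
  fun P hP h => hc P hP (hP.1.1.mem_of_pow_mem n h)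

theorem mem_tightClosure_of_frobLimMk_frobOrbit_eq_zero {c : R} (hc : c ∈ minPrimesCompl R)
    {e : ℕ} {g : FrobPow R p e M} (h : frobLimMk p c (frobOrbit p e g) = 0) :
    g ∈ tightClosure R p (⊥ : Submodule R (FrobPow R p e M)) := by
  obtain ⟨k, hk⟩ := frobLimMk_eq_zero_iff.1 h
  obtain ⟨n, -, hn⟩ := frobShift_pow_frobOrbit (p := p) (M := M) c k
  refine (mem_tightClosure_bot_iff g).2 ⟨c ^ n, pow_mem_minPrimesCompl hc n, k, fun j hj => ?_⟩
  rw [← hn e g j hj, hk]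
  rfl

end

theorem frobLimMk_frobOrbit_eq_zero {e₀ : ℕ} {c : R} (hc : IsWeakTestElement R p e₀ c)
    {M : Type u} [AddCommGroup M] [Module R M] [Module.Finite R M] {e : ℕ} {g : FrobPow R p e M}
    (hg : g ∈ tightClosure R p (⊥ : Submodule R (FrobPow R p e M))) :
    frobLimMk p c (frobOrbit p e g) = 0 := by
  -- the exponent `e₀ + 1` is positive, so that a factor `c` appears even for `e₀ = 0`
  refine frobLimMk_eq_zero_iff.2 ⟨e₀ + 1, ?_⟩
  obtain ⟨n, hn0, hn⟩ := frobShift_pow_frobOrbit (p := p) (M := M) c (e₀ + 1)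
  obtain ⟨n, rfl⟩ := Nat.exists_eq_succ_of_ne_zero (hn0 (by omega)).ne'
  funext i
  rcases lt_or_ge i (e + (e₀ + 1)) with hi | hi
  · exact frobShift_pow_frobOrbit_of_lt c _ g hi
  · obtain ⟨j, rfl⟩ := Nat.exists_eq_add_of_le hi
    rw [add_assoc, hn e g _ (by omega), pow_succ, mul_smul,
      hc.smul_frobPush_eq_zero hg (by omega), smul_zero]
    rfl

theorem smul_frobOrbit {M : Type v} [AddCommGroup M] [Module R M] (r : R) {e : ℕ}
    (g : FrobPow R p e M) : r • frobOrbit p e g = frobOrbit p e (r ^ p ^ e • g) := by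
  funext i
  rw [FrobProd.smul_apply]
  rcases lt_or_ge i e with hi | hi
  · rw [frobOrbit_of_lt _ hi, frobOrbit_of_lt _ hi, smul_zero]
  · obtain ⟨k, rfl⟩ := Nat.exists_eq_add_of_le hi
    rw [frobOrbit_add, frobOrbit_add, frobPush_smul, ← pow_mul, pow_add]

/-- Phantom regular elements are regular on `FrobLim`. -/
theorem IsPhantomRegular.isSMulRegular_frobLim {e₀ : ℕ} {c : R}
    (hc : IsWeakTestElement R p e₀ c) {M : Type u} [AddCommGroup M] [Module R M]
    [Module.Finite R M] {x : R} (hx : IsPhantomRegular R p M x) :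
    IsSMulRegular (FrobLim p M c) (C x : R[X]) := by
  refine (isSMulRegular_iff_right_eq_zero_of_smul (M := FrobLim p M c)).2 fun t ht => ?_
  obtain ⟨k, z, hz⟩ := exists_X_pow_smul_eq_frobLimMk c t
  refine eq_zero_of_X_pow_smul_eq_zero (k := k) ?_
  have h0 : frobLimMk p c (x • z) = 0 := by
    rw [← C_smul_frobLimMk, ← hz, smul_comm, ht, smul_zero]
  obtain ⟨l, hl⟩ := frobLimMk_eq_zero_iff.1 h0
  rw [LinearMap.map_smul] at hl
  rw [hz, frobLimMk_eq_zero_iff]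
  -- the `l`-th shift has its members in the tight closures of `0`, and `e₀ + 1` more shifts kill it
  refine ⟨e₀ + 1 + l, ?_⟩
  rw [pow_add, Module.End.mul_apply]
  exact frobShift_pow_eq_zero fun e k hk =>
    hc.smul_frobPush_eq_zero (hx.2 e _ (congrFun hl e)) hk

/-- `M` has a phantom socle element: some element of some `F^e(M)` outside the tight closure of
`0` is multiplied by the ideal `I` into that tight closure. -/
def HasPhantomSocle (p : ℕ) [Fact p.Prime] [CharP R p] (I : Ideal R) (M : Type v)
    [AddCommGroup M] [Module R M] : Prop :=
  ∃ (e : ℕ) (g : FrobPow R p e M), g ∉ tightClosure R p (⊥ : Submodule R (FrobPow R p e M)) ∧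
    ∀ r ∈ I, r • g ∈ tightClosure R p (⊥ : Submodule R (FrobPow R p e M))

theorem HasPhantomSocle.exists_frobLim {e₀ : ℕ} {c : R}
    (hc : IsWeakTestElement R p e₀ c) {M : Type u} [AddCommGroup M] [Module R M]
    [Module.Finite R M] {I : Ideal R} (h : HasPhantomSocle p I M) :
    ∃ t : FrobLim p M c, t ≠ 0 ∧ ∀ r ∈ I, (C r : R[X]) • t = 0 := by
  obtain ⟨e, g, hg, hI⟩ := h
  refine ⟨frobLimMk p c (frobOrbit p e g),
    fun h => hg (mem_tightClosure_of_frobLimMk_frobOrbit_eq_zero hc.1 h), fun r hr => ?_⟩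
  rw [C_smul_frobLimMk, smul_frobOrbit]
  obtain ⟨n, hn⟩ := Nat.exists_eq_succ_of_ne_zero (pow_ne_zero e (Fact.out : p.Prime).ne_zero)
  rw [hn, pow_succ, mul_smul]
  exact frobLimMk_frobOrbit_eq_zero hc (Submodule.smul_mem _ _ (hI r hr))

end Sequences

end

end PhantomDepth

/-! ### Vanishing of `Ext` along a multiplication sequence -/

namespace PhantomDepth

section

open CategoryTheory CategoryTheory.Abelian

section Ext

variable {A : Type u} [CommRing A] {J : Ideal A} {x : A}
  {T T' : Type u} [AddCommGroup T] [Module A T] [AddCommGroup T'] [Module A T']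
  {g : T →ₗ[A] T'}

/-- The short complex `0 → T → T → T' → 0` given by multiplication by `x` and a map `g`. -/
abbrev lsmulShortComplex (hex : Function.Exact (LinearMap.lsmul A T x) g) :
    ShortComplex (ModuleCat.{u} A) :=
  ModuleCat.shortComplexOfCompEqZero (LinearMap.lsmul A T x) g hex.linearMap_comp_eq_zero

theorem lsmulShortComplex_shortExact (hreg : IsSMulRegular T x)
    (hex : Function.Exact (LinearMap.lsmul A T x) g) (hg : Function.Surjective g) :
    (lsmulShortComplex hex).ShortExact where
  exact := ModuleCat.shortComplex_exact _ hex
  mono_f := (ModuleCat.mono_iff_injective _).2 hreg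
  epi_g := (ModuleCat.epi_iff_surjective _).2 hg

/-- Dimension shifting for `0 → T → T → T' → 0`: multiplication by `x ∈ J` is zero on
`Ext (A / J) T`, so by the long exact sequence each `Ext` of `T` is a quotient of the preceding one
of `T'`. -/
theorem subsingleton_ext_of_lsmul_exact (hx : x ∈ J) (hreg : IsSMulRegular T x)
    (hex : Function.Exact (LinearMap.lsmul A T x) g) (hg : Function.Surjective g) {n : ℕ}
    (h : ∀ i < n, Subsingleton (Ext (ModuleCat.of A (A ⧸ J)) (ModuleCat.of A T') i)) :
    ∀ i < n + 1, Subsingleton (Ext (ModuleCat.of A (A ⧸ J)) (ModuleCat.of A T) i) := by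
  intro i hi
  have hS := lsmulShortComplex_shortExact hreg hex hg
  have hann : x ∈ Module.annihilator A (ModuleCat.of A (A ⧸ J)) := by
    change x ∈ Module.annihilator A (A ⧸ J)
    rwa [Ideal.annihilator_quotient]
  have hzero := Ext.postcomp_smul_id_eq_zero_of_mem_annihilator
    (M := ModuleCat.of A T) (N := ModuleCat.of A (A ⧸ J)) hann i
  rw [subsingleton_iff_forall_eq 0]
  intro y
  have hy : y.comp (Ext.mk₀ (lsmulShortComplex hex).f) (add_zero i) = 0 :=
    congrArg (fun φ => φ.hom y) hzero
  cases i with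
  | zero =>
    have := hS.mono_f
    refine Ext.postcomp_mk₀_injective_of_mono _ (lsmulShortComplex hex).f ?_
    rw [map_zero]
    exact hy
  | succ i =>
    obtain ⟨y', rfl⟩ := Ext.covariant_sequence_exact₁ _ hS y hy rfl
    have := h i (by omega)
    rw [Subsingleton.elim y' 0, Ext.zero_comp]

theorem not_subsingleton_ext_of_lsmul_exact (hreg : IsSMulRegular T x)
    (hex : Function.Exact (LinearMap.lsmul A T x) g) (hg : Function.Surjective g) {n : ℕ}
    {K : ModuleCat.{u} A} (h : Subsingleton (Ext K (ModuleCat.of A T) n))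
    (h' : ¬ Subsingleton (Ext K (ModuleCat.of A T') n)) :
    ¬ Subsingleton (Ext K (ModuleCat.of A T) (n + 1)) := by
  intro h1
  have hS := lsmulShortComplex_shortExact hreg hex hg
  refine h' ((subsingleton_iff_forall_eq 0).2 fun y => ?_)
  obtain ⟨z, rfl⟩ := Ext.covariant_sequence_exact₃ K hS y rfl
    (Subsingleton.elim (α := Ext K (ModuleCat.of A T) (n + 1)) _ _)
  rw [Subsingleton.elim (α := Ext K (ModuleCat.of A T) n) z 0, Ext.zero_comp]

theorem not_subsingleton_ext_zero_of_exists {t : T} (ht : t ≠ 0) (h : ∀ r ∈ J, r • t = 0) :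
    ¬ Subsingleton (Ext (ModuleCat.of A (A ⧸ J)) (ModuleCat.of A T) 0) := by
  intro hs
  have : Subsingleton ((A ⧸ J) →ₗ[A] T) :=
    ((Ext.addEquiv₀ (X := ModuleCat.of A (A ⧸ J)) (Y := ModuleCat.of A T)).trans
      ModuleCat.homAddEquiv).symm.subsingleton
  let f : (A ⧸ J) →ₗ[A] T := Submodule.liftQ J (LinearMap.toSpanSingleton A T t) fun r hr => h r hr
  have h1 : f (Submodule.Quotient.mk 1) = t :=
    (Submodule.liftQ_apply J (LinearMap.toSpanSingleton A T t) 1).trans (one_smul A t)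
  exact ht (h1.symm.trans (by rw [Subsingleton.elim f 0]; rfl))

end Ext

end

end PhantomDepth

/-! ### Phantom regular sequences and `Ext` -/

namespace PhantomDepth

section

open Polynomial (X C)
open scoped Polynomial Pointwise
open CategoryTheory.Abelian (Ext)

section Sequences

variable {R : Type u} [CommRing R] {p : ℕ} [Fact p.Prime] [CharP R p]
  {M : Type v} [AddCommGroup M] [Module R M] {N : Type w} [AddCommGroup N] [Module R N]

theorem smul_top_ne_top_congr (f : M ≃ₗ[R] N) (I : Ideal R) :
    (I • ⊤ : Submodule R M) ≠ ⊤ ↔ (I • ⊤ : Submodule R N) ≠ ⊤ := by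
  rw [ne_eq, ne_eq, ← Submodule.Quotient.subsingleton_iff,
    ← Submodule.Quotient.subsingleton_iff,
    (Submodule.Quotient.equiv (I • ⊤ : Submodule R M) (I • ⊤ : Submodule R N) f
      (by simp [Submodule.map_smul''])).toEquiv.subsingleton_congr]

theorem isPhantomRegular_congr (f : M ≃ₗ[R] N) (x : R) :
    IsPhantomRegular R p M x ↔ IsPhantomRegular R p N x := by
  refine and_congr (smul_top_ne_top_congr f _) (forall_congr' fun e => ?_)
  refine (frobCongr R p e f).toEquiv.forall_congr fun z => ?_
  change _ ↔ (x ^ p ^ e • frobCongr R p e f z = 0 → frobCongr R p e f z ∈ _)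
  rw [frobCongr_mem_tightClosure_bot_iff, ← map_smul, LinearEquiv.map_eq_zero_iff]

theorem isPhantomRegularSeq_congr (f : M ≃ₗ[R] N) (xs : List R) :
    IsPhantomRegularSeq R p M xs ↔ IsPhantomRegularSeq R p N xs :=
  and_congr (smul_top_ne_top_congr f _) <| forall₂_congr fun _ _ =>
    isPhantomRegular_congr (Submodule.Quotient.equiv _ _ f (by simp [Submodule.map_smul''])) _

theorem HasPhantomSocle.congr (f : M ≃ₗ[R] N) {I : Ideal R} (h : HasPhantomSocle p I M) :
    HasPhantomSocle p I N := by
  obtain ⟨e, g, hg, hI⟩ := h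
  refine ⟨e, frobCongr R p e f g, by rwa [frobCongr_mem_tightClosure_bot_iff], fun r hr => ?_⟩
  rw [← map_smul, frobCongr_mem_tightClosure_bot_iff]
  exact hI r hr

variable (M) in
/-- The quotient by the empty sequence. -/
noncomputable def quotOfListNil : (M ⧸ (Ideal.ofList ([] : List R) • ⊤ : Submodule R M)) ≃ₗ[R] M :=
  Submodule.quotEquivOfEqBot _ (by rw [Ideal.ofList_nil, Submodule.bot_smul])

theorem isPhantomRegularSeq_cons_iff (x : R) (xs : List R) :
    IsPhantomRegularSeq R p M (x :: xs) ↔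
      IsPhantomRegular R p M x ∧ IsPhantomRegularSeq R p (QuotSMulTop x M) xs := by
  have h1 : (Ideal.ofList (x :: xs) • ⊤ : Submodule R M) ≠ ⊤ ↔
      (Ideal.ofList xs • ⊤ : Submodule R (QuotSMulTop x M)) ≠ ⊤ :=
    not_congr <| eq_comm.trans <| (Submodule.top_eq_ofList_cons_smul_iff x xs).trans eq_comm
  have hs (i : ℕ) (hi : i < xs.length) :
      IsPhantomRegular R p (M ⧸ (Ideal.ofList ((x :: xs).take (i + 1)) • ⊤ : Submodule R M))
        (xs[i]) ↔ IsPhantomRegular R p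
        (QuotSMulTop x M ⧸ (Ideal.ofList (xs.take i) • ⊤ : Submodule R (QuotSMulTop x M))) xs[i] :=
    isPhantomRegular_congr
      (Submodule.quotOfListConsSMulTopEquivQuotSMulTopInner M x (xs.take i)) _
  have h0 : IsPhantomRegular R p (M ⧸ (Ideal.ofList ((x :: xs).take 0) • ⊤ : Submodule R M)) x ↔
      IsPhantomRegular R p M x := isPhantomRegular_congr (quotOfListNil M) x
  constructor
  · rintro ⟨ht, h⟩
    exact ⟨h0.1 (h 0 (by simp)), h1.1 ht, fun i hi => (hs i hi).1 (h (i + 1) (by simpa using hi))⟩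
  · rintro ⟨hx, ht, h⟩
    refine ⟨h1.2 ht, fun i hi => ?_⟩
    cases i with
    | zero => exact h0.2 hx
    | succ i => exact (hs i (by simpa using hi)).2 (h i (by simpa using hi))

end Sequences

section Bound

variable {R : Type u} [CommRing R] {p : ℕ} [Fact p.Prime] [CharP R p] {e₀ : ℕ} {c : R}
  {J : Ideal R} {M : Type u} [AddCommGroup M] [Module R M] [Module.Finite R M]

theorem IsPhantomRegularSeq.subsingleton_ext (hc : IsWeakTestElement R p e₀ c) {xs : List R}
    (hxs : IsPhantomRegularSeq R p M xs) (hJ : ∀ x ∈ xs, x ∈ J) :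
    ∀ i < xs.length, Subsingleton (Ext (ModuleCat.of R[X] (R[X] ⧸ J.map C))
      (ModuleCat.of R[X] (FrobLim p M c)) i) := by
  induction xs generalizing M with
  | nil => simp
  | cons x xs ih =>
    rw [isPhantomRegularSeq_cons_iff] at hxs
    exact subsingleton_ext_of_lsmul_exact (Ideal.mem_map_of_mem C (hJ x (by simp)))
      (hxs.1.isSMulRegular_frobLim hc) (exact_frobLimMap c x M)
      (frobLimMap_surjective c (Submodule.mkQ_surjective _))
      (ih hxs.2 fun y hy => hJ y (by simp [hy]))

theorem IsPhantomRegularSeq.not_subsingleton_ext (hc : IsWeakTestElement R p e₀ c) {xs : List R}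
    (hxs : IsPhantomRegularSeq R p M xs) (hJ : ∀ x ∈ xs, x ∈ J)
    (hs : HasPhantomSocle p J (M ⧸ (Ideal.ofList xs • ⊤ : Submodule R M))) :
    ¬ Subsingleton (Ext (ModuleCat.of R[X] (R[X] ⧸ J.map C))
      (ModuleCat.of R[X] (FrobLim p M c)) xs.length) := by
  induction xs generalizing M with
  | nil =>
    obtain ⟨t, ht, h⟩ := (hs.congr (quotOfListNil M)).exists_frobLim hc
    have : J.map C ≤ Ideal.torsionOf R[X] (FrobLim p M c) t :=
      Ideal.map_le_iff_le_comap.2 fun r hr => h r hr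
    exact not_subsingleton_ext_zero_of_exists ht fun r hr => this hr
  | cons x xs ih =>
    have h1 := hxs.subsingleton_ext hc hJ xs.length (by simp)
    rw [isPhantomRegularSeq_cons_iff] at hxs
    exact not_subsingleton_ext_of_lsmul_exact
      (hxs.1.isSMulRegular_frobLim hc) (exact_frobLimMap c x M)
      (frobLimMap_surjective c (Submodule.mkQ_surjective _)) h1
      (ih hxs.2 (fun y hy => hJ y (by simp [hy]))
        (hs.congr (Submodule.quotOfListConsSMulTopEquivQuotSMulTopInner M x xs)))

/-- A phantom regular sequence whose quotient has a phantom socle element has the largest possible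
length: it is detected by the first nonvanishing `Ext` into `FrobLim`. -/
theorem IsPhantomRegularSeq.length_le_of_hasPhantomSocle (hc : IsWeakTestElement R p e₀ c)
    {xs ys : List R}
    (hxs : IsPhantomRegularSeq R p M xs) (hxJ : ∀ x ∈ xs, x ∈ J)
    (hs : HasPhantomSocle p J (M ⧸ (Ideal.ofList xs • ⊤ : Submodule R M)))
    (hys : IsPhantomRegularSeq R p M ys) (hyJ : ∀ y ∈ ys, y ∈ J) : ys.length ≤ xs.length := by
  by_contra! h
  exact hxs.not_subsingleton_ext hc hxJ hs (hys.subsingleton_ext hc hyJ _ h)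

variable [IsLocalRing R]

theorem IsPhantomRegularSeq.phantomDepth_eq_length (hc : IsWeakTestElement R p e₀ c)
    {xs : List R} (hxs : IsPhantomRegularSeq R p M xs)
    (hxm : ∀ x ∈ xs, x ∈ IsLocalRing.maximalIdeal R)
    (hs : HasPhantomSocle p (IsLocalRing.maximalIdeal R)
      (M ⧸ (Ideal.ofList xs • ⊤ : Submodule R M))) :
    phantomDepth R p M = xs.length :=
  le_antisymm
    (iSup₂_le fun _ h => Nat.cast_le.2 (hxs.length_le_of_hasPhantomSocle hc hxm hs h.2 h.1))
    (le_iSup₂_of_le xs ⟨hxm, hxs⟩ le_rfl)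

theorem IsPhantomRegularSeq.isMaximal (hc : IsWeakTestElement R p e₀ c)
    {xs : List R} (hxs : IsPhantomRegularSeq R p M xs)
    (hxm : ∀ x ∈ xs, x ∈ IsLocalRing.maximalIdeal R)
    (hs : HasPhantomSocle p (IsLocalRing.maximalIdeal R)
      (M ⧸ (Ideal.ofList xs • ⊤ : Submodule R M))) :
    IsMaximalPhantomRegularSeq R p M xs := by
  refine ⟨hxm, hxs, fun y hy h => ?_⟩
  have := hxs.length_le_of_hasPhantomSocle hc hxm hs h (by
    simp only [List.mem_append, List.mem_singleton]
    rintro z (hz | rfl)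
    exacts [hxm z hz, hy])
  simp at this

end Bound

end

end PhantomDepth

/-! ### Maximal phantom regular sequences -/

namespace PhantomDepth

section

open scoped Pointwise

section Existence

variable {R : Type u} [CommRing R] {p : ℕ} [Fact p.Prime] [CharP R p]

theorem ne_zero_of_mem_minPrimesCompl [Nontrivial R] {c : R} (hc : c ∈ minPrimesCompl R) :
    c ≠ 0 := by
  rintro rfl
  obtain ⟨P, hP⟩ := Ideal.nonempty_minimalPrimes (bot_ne_top (α := Ideal R))
  exact hc P hP P.zero_mem

/-- A multiple of `1 ^ p ^ e` that vanishes in `F^e(R / I)` has its coefficient in `I ^ p ^ e`. -/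
theorem mem_pow_of_smul_frobElt_one_eq_zero {I : Ideal R} {e : ℕ} {c : R}
    (h : c • frobElt R p e (1 : R ⧸ I) = 0) : c ∈ I ^ p ^ e := by
  let g : R ⧸ I →+* R ⧸ I ^ p ^ e :=
    Ideal.Quotient.lift I ((Ideal.Quotient.mk _).comp (iterateFrobenius R p e)) fun a ha => by
      rw [RingHom.comp_apply, Ideal.Quotient.eq_zero_iff_mem, iterateFrobenius_def]
      exact Ideal.pow_mem_pow ha _
  let l := frobLift (p := p) (RingHom.id R) e g.toAddMonoidHom (by
    intro r m
    obtain ⟨m, rfl⟩ := Ideal.Quotient.mk_surjective m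
    simp only [RingHom.toAddMonoidHom_eq_coe, AddMonoidHom.coe_coe, RingHom.id_apply]
    change (Ideal.Quotient.mk _) ((iterateFrobenius R p e) (r * m)) =
      (Ideal.Quotient.mk _) (r ^ p ^ e * (iterateFrobenius R p e) m)
    rw [map_mul, iterateFrobenius_def])
  have h1 := congrArg l h
  rw [LinearMap.map_smul, frobLift_frobElt, map_zero] at h1
  rw [← Ideal.Quotient.eq_zero_iff_mem]
  simpa [Algebra.smul_def] using h1

/-- A nonzero finitely generated module over a local ring is not the tight closure of its zero
submodule: otherwise the same would hold for the residue field, and an element of `R°` would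
lie in all powers of the maximal ideal. -/
theorem exists_frobElt_notMem_tightClosure_bot [IsLocalRing R] [IsNoetherianRing R]
    (M : Type v) [AddCommGroup M] [Module R M] [Module.Finite R M] [Nontrivial M] :
    ∃ m : M, frobElt R p 0 m ∉ tightClosure R p (⊥ : Submodule R (FrobPow R p 0 M)) := by
  obtain ⟨K, hK, -⟩ := (eq_top_or_exists_le_coatom (⊥ : Submodule R M)).resolve_left bot_ne_top
  have hs : IsSimpleModule R (M ⧸ K) := isSimpleModule_iff_isCoatom.2 hK
  obtain ⟨I, hI, ⟨f⟩⟩ := isSimpleModule_iff_quot_maximal.1 hs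
  obtain ⟨m, hm⟩ := (f.surjective.comp K.mkQ_surjective) 1
  refine ⟨m, fun h => ?_⟩
  obtain ⟨c, hc, e₀, h⟩ := (mem_tightClosure_bot_iff _).1
    (map_mem_tightClosure_bot (f.toLinearMap ∘ₗ K.mkQ) h)
  refine ne_zero_of_mem_minPrimesCompl hc ?_
  rw [← Submodule.mem_bot R, ← Ideal.iInf_pow_eq_bot_of_isLocalRing I hI.ne_top,
    Submodule.mem_iInf]
  intro i
  have h1 := h (e₀ + i) (by omega)
  rw [frobMap_frobElt, frobPush_frobElt,
    show (f.toLinearMap ∘ₗ K.mkQ) m = 1 from hm] at h1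
  refine Ideal.pow_le_pow_right ?_ (mem_pow_of_smul_frobElt_one_eq_zero h1)
  exact le_trans (by omega) (Nat.lt_pow_self (Fact.out : p.Prime).one_lt).le

section

variable [IsLocalRing R] {M : Type v} [AddCommGroup M] [Module R M] [Module.Finite R M]

theorem ofList_smul_top_ne_top [Nontrivial M] {xs : List R}
    (hx : ∀ x ∈ xs, x ∈ IsLocalRing.maximalIdeal R) : (Ideal.ofList xs • ⊤ : Submodule R M) ≠ ⊤ :=
  (Submodule.top_ne_ideal_smul_of_le_jacobson_annihilator
    ((Ideal.span_le.2 hx).trans (IsLocalRing.maximalIdeal_le_jacobson _))).symm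

theorem IsPhantomRegularSeq.append_singleton {xs : List R} {y : R}
    (h : IsPhantomRegularSeq R p M xs) (hx : ∀ x ∈ xs, x ∈ IsLocalRing.maximalIdeal R)
    (hy : y ∈ IsLocalRing.maximalIdeal R)
    (hreg : IsPhantomRegular R p (M ⧸ (Ideal.ofList xs • ⊤ : Submodule R M)) y) :
    IsPhantomRegularSeq R p M (xs ++ [y]) := by
  have : Nontrivial M := by
    by_contra hM
    rw [not_nontrivial_iff_subsingleton] at hM
    exact h.1 (Subsingleton.elim _ _)
  refine ⟨ofList_smul_top_ne_top ?_, fun i hi => ?_⟩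
  · simp only [List.mem_append, List.mem_singleton]
    rintro z (hz | rfl)
    exacts [hx z hz, hy]
  · rcases lt_or_ge i xs.length with hlt | hge
    · have := h.2 i hlt
      rwa [List.getElem_append_left hlt, List.take_append_of_le_length hlt.le]
    · obtain rfl : i = xs.length :=
        le_antisymm (by simpa using Nat.le_of_lt_succ (by simpa using hi)) hge
      rwa [List.getElem_concat_length rfl, List.take_left]

/-- For a module with avoidance, the quotient by a maximal phantom regular sequence has a phantom
socle element: every element of the maximal ideal is a zero divisor on some `G^e`, so that the
maximal ideal is associated to a single `G^e`. -/
theorem IsMaximalPhantomRegularSeq.hasPhantomSocle [IsNoetherianRing R]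
    (hM : SatisfiesAvoidance R p M) {xs : List R} (hxs : IsMaximalPhantomRegularSeq R p M xs) :
    HasPhantomSocle p (IsLocalRing.maximalIdeal R)
      (M ⧸ (Ideal.ofList xs • ⊤ : Submodule R M)) := by
  obtain ⟨hxm, hseq, hmax⟩ := hxs
  have hN : Nontrivial (M ⧸ (Ideal.ofList xs • ⊤ : Submodule R M)) :=
    Submodule.Quotient.nontrivial_iff.2 hseq.1
  obtain ⟨e, P, hP, hle⟩ := hM (Ideal.ofList xs • ⊤) (IsLocalRing.maximalIdeal R) (by
    intro y hy
    by_contra hy'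
    refine hmax y hy (hseq.append_singleton hxm hy ⟨?_, fun e z hz => ?_⟩)
    · rw [← Ideal.ofList_singleton]
      exact ofList_smul_top_ne_top (by simpa using hy)
    · have hreg :
          IsSMulRegular (RedFrobPow R p e (M ⧸ (Ideal.ofList xs • ⊤ : Submodule R M))) y := by
        by_contra hreg
        have : y ∈ ({r | IsSMulRegular (RedFrobPow R p e
          (M ⧸ (Ideal.ofList xs • ⊤ : Submodule R M))) r}ᶜ : Set R) := hreg
        rw [← biUnion_associatedPrimes_eq_compl_regular] at this
        exact hy' (Set.mem_iUnion_of_mem e this)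
      rw [← Submodule.Quotient.mk_eq_zero]
      refine (hreg.pow (p ^ e)).right_eq_zero_of_smul ?_
      rw [← Submodule.Quotient.mk_smul, hz, Submodule.Quotient.mk_zero])
  obtain ⟨hPp, g, hg⟩ := isAssociatedPrime_iff.1 hP
  obtain ⟨g, rfl⟩ := Submodule.Quotient.mk_surjective _ g
  have hmem : ∀ r ∈ P, r • g ∈
      tightClosure R p
        (⊥ : Submodule R (FrobPow R p e (M ⧸ (Ideal.ofList xs • ⊤ : Submodule R M)))) := by
    intro r hr
    rw [hg, Submodule.mem_colon_singleton, Submodule.mem_bot, ← Submodule.Quotient.mk_smul,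
      Submodule.Quotient.mk_eq_zero] at hr
    exact hr
  refine ⟨e, g, fun h => hPp.ne_top ?_, fun r hr => ?_⟩
  · rw [hg, Ideal.eq_top_iff_one, Submodule.mem_colon_singleton, Submodule.mem_bot,
      (Submodule.Quotient.mk_eq_zero _).2 h, smul_zero]
  · exact hmem r (hle hr)

variable (p M) in
/-- Maximal phantom regular sequences exist: in a strictly increasing extension, each new element
lies outside the ideal generated by its predecessors, because an element annihilating a nonzero
module is not phantom regular on it. -/
theorem exists_isMaximalPhantomRegularSeq [IsNoetherianRing R] [Nontrivial M] :
    ∃ xs : List R, IsMaximalPhantomRegularSeq R p M xs := by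
  let 𝒮 : Set (Ideal R) := {I | ∃ xs : List R, (∀ x ∈ xs, x ∈ IsLocalRing.maximalIdeal R) ∧
    IsPhantomRegularSeq R p M xs ∧ Ideal.ofList xs = I}
  obtain ⟨_, ⟨xs, hxm, hxs, rfl⟩, hmax⟩ := set_has_maximal_iff_noetherian.2
    (inferInstance : IsNoetherian R R) 𝒮
    ⟨_, [], by simp, ⟨ofList_smul_top_ne_top (by simp), by simp⟩, rfl⟩
  refine ⟨xs, hxm, hxs, fun y hy h => ?_⟩
  have hN : Nontrivial (M ⧸ (Ideal.ofList xs • ⊤ : Submodule R M)) :=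
    Submodule.Quotient.nontrivial_iff.2 hxs.1
  have hle : Ideal.ofList xs ≤ Ideal.ofList (xs ++ [y]) := by
    rw [Ideal.ofList_append]
    exact le_sup_left
  have heq := eq_of_le_of_not_lt hle (hmax _ ⟨xs ++ [y], by
    simp only [List.mem_append, List.mem_singleton]
    rintro z (hz | rfl)
    exacts [hxm z hz, hy], h, rfl⟩)
  have hyx : y ∈ Ideal.ofList xs := heq ▸ Ideal.subset_span (by simp)
  have hreg := h.2 xs.length (by simp)
  rw [List.getElem_concat_length rfl, List.take_left] at hreg
  obtain ⟨n, hn⟩ := exists_frobElt_notMem_tightClosure_bot (R := R) (p := p)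
    (M ⧸ (Ideal.ofList xs • ⊤ : Submodule R M))
  refine hn (hreg.2 0 _ ?_)
  obtain ⟨m, rfl⟩ := Submodule.Quotient.mk_surjective _ n
  rw [← frobElt_smul, ← Submodule.Quotient.mk_smul, (Submodule.Quotient.mk_eq_zero _).2
    (Submodule.smul_mem_smul hyx Submodule.mem_top), frobElt_zero]

end

end Existence

end

end PhantomDepth

/-! ### Sequences regular on the closed fiber of a flat local homomorphism -/

namespace PhantomDepth

section

open scoped Pointwise
open RingTheory.Sequence

section Regular

variable {S : Type u} [CommRing S]

/-- Weak regularity of a sequence passes to extensions. -/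
theorem isWeaklyRegular_of_exact {X₁ X₂ X₃ : Type*} [AddCommGroup X₁] [Module S X₁]
    [AddCommGroup X₂] [Module S X₂] [AddCommGroup X₃] [Module S X₃] {f : X₁ →ₗ[S] X₂}
    {g : X₂ →ₗ[S] X₃} (hf : Function.Injective f) (hfg : Function.Exact f g)
    (hg : Function.Surjective g) {zs : List S} (h₁ : IsWeaklyRegular X₁ zs)
    (h₃ : IsWeaklyRegular X₃ zs) : IsWeaklyRegular X₂ zs := by
  induction zs generalizing X₁ X₂ X₃ with
  | nil => exact .nil S X₂
  | cons z zs ih =>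
    rw [isWeaklyRegular_cons_iff] at h₁ h₃ ⊢
    refine ⟨isSMulRegular_of_range_eq_ker hf hfg.linearMap_ker_eq.symm h₁.1 h₃.1,
      ih ?_ (QuotSMulTop.map_exact z hfg hg) (QuotSMulTop.map_surjective z hg) h₁.2 h₃.2⟩
    have := QuotSMulTop.map_first_exact_on_four_term_exact_of_isSMulRegular_last
      ((LinearMap.exact_zero_iff_injective X₁ f).2 hf) hfg h₃.1
    rw [map_zero] at this
    exact (LinearMap.exact_zero_iff_injective _ _).1 this

/-- Powers of the members of a regular sequence form a regular sequence: as the sequence may be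
permuted, its members can be replaced by powers one at a time, in the last place. -/
theorem isWeaklyRegular_map_pow [IsLocalRing S] [IsNoetherianRing S] {X : Type*} [AddCommGroup X]
    [Module S X] [Module.Finite S X] {zs : List S} (h : IsWeaklyRegular X zs)
    (hz : ∀ z ∈ zs, z ∈ IsLocalRing.maximalIdeal S) (n : ℕ) :
    IsWeaklyRegular X (zs.map (· ^ (n + 1))) := by
  induction zs generalizing X with
  | nil => exact .nil S X
  | cons z zs ih =>
    have h1 := IsLocalRing.isWeaklyRegular_of_perm_of_subset_maximalIdeal h
      (List.perm_append_singleton z zs).symm hz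
    have h2 : IsWeaklyRegular X (zs ++ [z ^ (n + 1)]) := by
      rw [isWeaklyRegular_append_iff, isWeaklyRegular_singleton_iff] at h1 ⊢
      exact ⟨h1.1, h1.2.pow _⟩
    have h3 := IsLocalRing.isWeaklyRegular_of_perm_of_subset_maximalIdeal h2
      (List.perm_append_singleton (z ^ (n + 1)) zs) (by
        simp only [List.mem_append, List.mem_singleton]
        rintro y (hy | rfl)
        exacts [hz y (by simp [hy]), Ideal.pow_mem_of_mem _ (hz z (by simp)) _ (by omega)])
    rw [isWeaklyRegular_cons_iff] at h3
    rw [List.map_cons, isWeaklyRegular_cons_iff]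
    exact ⟨h3.1, ih h3.2 fun y hy => hz y (by simp [hy])⟩

theorem map_mem_of_mem_smul_top {X : Type*} [AddCommGroup X] [Module S X] (r : X →ₗ[S] S)
    {I : Ideal S} {x : X} (h : x ∈ (I • ⊤ : Submodule S X)) : r x ∈ I := by
  refine Submodule.smul_induction_on h (fun a ha y _ => ?_) fun a b ha hb => ?_
  · rw [map_smul, smul_eq_mul]
    exact Ideal.mul_mem_right _ _ ha
  · rw [map_add]
    exact I.add_mem ha hb

end Regular

section Fiber

variable {R S : Type u} [CommRing R] [CommRing S] [Algebra R S]

theorem rid_baseChange_subtype_mem_map {W I : Ideal R} (hW : W ≤ I) (y : S ⊗[R] W) :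
    AlgebraTensorModule.rid R S S (W.subtype.baseChange S y) ∈ I.map (algebraMap R S) := by
  induction y using TensorProduct.induction_on with
  | zero => rw [map_zero, map_zero]; exact Submodule.zero_mem _
  | tmul a b =>
    rw [LinearMap.baseChange_tmul, AlgebraTensorModule.rid_tmul, Algebra.smul_def]
    exact Ideal.mul_mem_right _ _ (Ideal.mem_map_of_mem _ (hW b.2))
  | add a b ha hb =>
    rw [map_add, map_add]
    exact Submodule.add_mem _ ha hb

variable [IsLocalRing R] [IsNoetherianRing R] [Module.Flat R S]

/-- The case of finite length: a prime filtration of `L` has only copies of the residue field as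
factors, and `S ⊗ -` turns them into copies of the closed fiber. -/
theorem isWeaklyRegular_tensor_of_pow_le_annihilator {zs : List S}
    (hzs : IsWeaklyRegular (ClosedFiber R S) zs) (j : ℕ) (L : Type u) [AddCommGroup L]
    [Module R L] [Module.Finite R L]
    (hL : IsLocalRing.maximalIdeal R ^ j ≤ Module.annihilator R L) :
    IsWeaklyRegular (S ⊗[R] L) zs := by
  refine IsNoetherianRing.induction_on_isQuotientEquivQuotientPrime R
    (motive := fun L _ _ _ => IsLocalRing.maximalIdeal R ^ j ≤ Module.annihilator R L →
      IsWeaklyRegular (S ⊗[R] L) zs) (M := L) inferInstance ?_ ?_ ?_ hL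
  · intro L _ _ _ _ _
    have : Subsingleton (S ⊗[R] L) := subsingleton_of_forall_eq 0 fun x => by
      induction x using TensorProduct.induction_on with
      | zero => rfl
      | tmul a b => rw [Subsingleton.elim b 0, tmul_zero]
      | add a b ha hb => rw [ha, hb, add_zero]
    exact ⟨fun i hi x y _ => Subsingleton.elim _ _⟩
  · intro L _ _ _ P f hL
    rw [f.annihilator_eq, Ideal.annihilator_quotient] at hL
    have hP : P.1 = IsLocalRing.maximalIdeal R :=
      le_antisymm (IsLocalRing.le_maximalIdeal P.2.ne_top) (Ideal.IsPrime.le_of_pow_le hL)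
    rw [hP] at f
    exact (((Algebra.TensorProduct.quotIdealMapEquivTensorQuot S
      (IsLocalRing.maximalIdeal R)).toLinearEquiv.trans
        (f.symm.baseChange R S _ _)).isWeaklyRegular_congr zs).1 hzs
  · intro L₁ _ _ _ L₂ _ _ _ L₃ _ _ _ f g hf hg hfg h₁ h₃ hL
    refine isWeaklyRegular_of_exact (f := f.baseChange S) (g := g.baseChange S)
      (Module.Flat.lTensor_preserves_injective_linearMap f hf) (lTensor_exact S hfg hg)
      (LinearMap.lTensor_surjective S hg)
      (h₁ (hL.trans (f.annihilator_le_of_injective hf)))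
      (h₃ (hL.trans (g.annihilator_le_of_surjective hg)))

variable [IsLocalRing S] [IsNoetherianRing S] [IsLocalHom (algebraMap R S)]

/-- Local criterion of flatness in the form used here: a sequence that is regular on the closed
fiber is regular on `S ⊗ L` for every finitely generated `R`-module `L`. For `L` of finite length
this follows by filtering `L`; the general case follows from Krull's intersection theorem. -/
theorem isWeaklyRegular_tensor {zs : List S}
    (hzs : IsWeaklyRegular (ClosedFiber R S) zs) (L : Type u)
    [AddCommGroup L] [Module R L] [Module.Finite R L] : IsWeaklyRegular (S ⊗[R] L) zs := by
  refine ⟨fun i hi => (isSMulRegular_quotient_iff_mem_of_smul_mem _ _).2 fun x hx => ?_⟩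
  set I := Ideal.ofList (zs.take i)
  set m := IsLocalRing.maximalIdeal R
  -- modulo every power of the maximal ideal of `R`, the element `x` lies in the submodule
  have key (j : ℕ) : x ∈ (I • ⊤ : Submodule S (S ⊗[R] L)) ⊔
      (IsLocalRing.maximalIdeal S ^ j • ⊤ : Submodule S (S ⊗[R] L)) := by
    have hw := isWeaklyRegular_tensor_of_pow_le_annihilator hzs j
      (L ⧸ (m ^ j • ⊤ : Submodule R L)) (by
        intro r hr
        rw [Module.mem_annihilator]
        intro y
        obtain ⟨y, rfl⟩ := Submodule.Quotient.mk_surjective _ y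
        rw [← Submodule.Quotient.mk_smul, Submodule.Quotient.mk_eq_zero]
        exact Submodule.smul_mem_smul hr Submodule.mem_top)
    rw [← (tensorQuotMapSMulEquivTensorQuot L S (m ^ j)).isWeaklyRegular_congr zs] at hw
    set Y : Submodule S (S ⊗[R] L) := (m ^ j).map (algebraMap R S) • ⊤
    have h1 := (isSMulRegular_quotient_iff_mem_of_smul_mem _ _).1 (hw.1 i hi) (Y.mkQ x) (by
      rw [← map_smul, ← Submodule.mem_comap,
        Submodule.comap_smul_top_of_surjective I _ Y.mkQ_surjective]
      exact Submodule.mem_sup_left hx)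
    rw [← Submodule.mem_comap, Submodule.comap_smul_top_of_surjective I _ Y.mkQ_surjective,
      Submodule.ker_mkQ] at h1
    refine (show _ ⊔ _ ≤ (_ : Submodule S (S ⊗[R] L)) from
      sup_le_sup le_rfl (Submodule.smul_mono_left ?_)) h1
    rw [Ideal.map_pow]
    exact Ideal.pow_right_mono (((IsLocalRing.local_hom_TFAE (algebraMap R S)).out 0 2).1 ‹_›) j
  rw [← Submodule.Quotient.mk_eq_zero, ← Submodule.mem_bot S,
    ← Ideal.iInf_pow_smul_eq_bot_of_isLocalRing (IsLocalRing.maximalIdeal S)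
      (Ideal.IsPrime.ne_top inferInstance), Submodule.mem_iInf]
  intro j
  change (I • ⊤ : Submodule S (S ⊗[R] L)).mkQ x ∈ _
  rw [← Submodule.mem_comap,
    Submodule.comap_smul_top_of_surjective _ _ (Submodule.mkQ_surjective _),
    Submodule.ker_mkQ, sup_comm]
  exact key j

/-- If `s ⊗ v` vanishes modulo a sequence regular on the closed fiber and `s` does not vanish in
the closed fiber modulo the sequence, then `v = 0`: by flatness `s` lies, modulo the sequence, in
the extension of the annihilator of `v`. -/
theorem eq_zero_of_tmul_mem_ofList_smul_top {zs : List S}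
    (hzs : IsWeaklyRegular (ClosedFiber R S) zs) {L : Type u}
    [AddCommGroup L] [Module R L] [Module.Finite R L] {s : S} {v : L}
    (h : s ⊗ₜ[R] v ∈ (Ideal.ofList zs • ⊤ : Submodule S (S ⊗[R] L)))
    (hs : s ∉ (IsLocalRing.maximalIdeal R).map (algebraMap R S) ⊔ Ideal.ofList zs) : v = 0 := by
  by_contra hv
  let f := LinearMap.toSpanSingleton R L v
  have h₁₂ : Function.Exact ((LinearMap.ker f).subtype.baseChange S) (f.baseChange S) :=
    Module.Flat.lTensor_exact S (LinearMap.exact_subtype_ker_map f)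
  have h₂₃ : Function.Exact (f.baseChange S) ((LinearMap.range f).mkQ.baseChange S) :=
    lTensor_exact S (LinearMap.exact_map_mkQ_range f) (Submodule.mkQ_surjective _)
  have hex := map_first_exact_on_four_term_right_exact_of_isSMulRegular_last h₁₂ h₂₃
    (LinearMap.lTensor_surjective S (Submodule.mkQ_surjective _))
    (isWeaklyRegular_tensor hzs (L ⧸ LinearMap.range f))
  obtain ⟨y, hy⟩ := (hex (Submodule.Quotient.mk (s ⊗ₜ[R] (1 : R)))).1 (by
    rw [Submodule.mapQ_apply, Submodule.Quotient.mk_eq_zero]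
    simpa [f] using h)
  obtain ⟨y, rfl⟩ := Submodule.Quotient.mk_surjective _ y
  rw [Submodule.mapQ_apply, Submodule.Quotient.eq] at hy
  let r : S ⊗[R] R →ₗ[S] S := (AlgebraTensorModule.rid R S S).toLinearMap
  have hr : ∀ (a : S) (b : R), r (a ⊗ₜ b) = a * algebraMap R S b := fun a b => by
    simp [r, Algebra.smul_def, mul_comm]
  have h1 : r ((LinearMap.ker f).subtype.baseChange S y - s ⊗ₜ[R] (1 : R)) ∈ Ideal.ofList zs :=
    map_mem_of_mem_smul_top r hy
  have h2 : r ((LinearMap.ker f).subtype.baseChange S y) ∈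
      (IsLocalRing.maximalIdeal R).map (algebraMap R S) := by
    refine rid_baseChange_subtype_mem_map (IsLocalRing.le_maximalIdeal fun h => hv ?_) y
    have : (1 : R) ∈ LinearMap.ker f := h ▸ Submodule.mem_top
    simpa [f] using this
  refine hs ?_
  have h3 : s = r ((LinearMap.ker f).subtype.baseChange S y) -
      r ((LinearMap.ker f).subtype.baseChange S y - s ⊗ₜ[R] (1 : R)) := by
    rw [map_sub, hr]
    simp
  rw [h3]
  exact Submodule.sub_mem _ (Ideal.mem_sup_left h2) (Ideal.mem_sup_right h1)

end Fiber

end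

end PhantomDepth

/-! ### Depth, systems of parameters and `F`-injectivity -/

namespace PhantomDepth

section

open scoped Pointwise
open RingTheory.Sequence
open CategoryTheory.Abelian (Ext)

section Depth

variable {A : Type u} [CommRing A] {J : Ideal A} {T : Type u} [AddCommGroup T] [Module A T]

theorem subsingleton_ext_of_isWeaklyRegular {xs : List A} (hxs : IsWeaklyRegular T xs)
    (hJ : ∀ x ∈ xs, x ∈ J) : ∀ i < xs.length,
      Subsingleton (Ext (ModuleCat.of A (A ⧸ J)) (ModuleCat.of A T) i) := by
  induction xs generalizing T with
  | nil => simp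
  | cons x xs ih =>
    rw [isWeaklyRegular_cons_iff] at hxs
    exact subsingleton_ext_of_lsmul_exact (hJ x (by simp)) hxs.1
      (LinearMap.exact_lsmul_mkQ_smul_top T x) (Submodule.mkQ_surjective _)
      (ih hxs.2 fun y hy => hJ y (by simp [hy]))

theorem not_subsingleton_ext_of_isWeaklyRegular {xs : List A} (hxs : IsWeaklyRegular T xs)
    (hJ : ∀ x ∈ xs, x ∈ J)
    (hs : ∃ t : T ⧸ (Ideal.ofList xs • ⊤ : Submodule A T), t ≠ 0 ∧ ∀ r ∈ J, r • t = 0) :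
    ¬ Subsingleton (Ext (ModuleCat.of A (A ⧸ J)) (ModuleCat.of A T) xs.length) := by
  induction xs generalizing T with
  | nil =>
    obtain ⟨t, ht, h⟩ := hs
    refine not_subsingleton_ext_zero_of_exists (t := quotOfListNil T t)
      (by simpa using ht) fun r hr => ?_
    rw [← map_smul, h r hr, map_zero]
  | cons x xs ih =>
    have h1 := subsingleton_ext_of_isWeaklyRegular hxs hJ xs.length (by simp)
    rw [isWeaklyRegular_cons_iff] at hxs
    refine not_subsingleton_ext_of_lsmul_exact hxs.1
      (LinearMap.exact_lsmul_mkQ_smul_top T x) (Submodule.mkQ_surjective _) h1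
      (ih hxs.2 (fun y hy => hJ y (by simp [hy])) ?_)
    obtain ⟨t, ht, h⟩ := hs
    refine ⟨Submodule.quotOfListConsSMulTopEquivQuotSMulTopInner T x xs t, by simpa using ht,
      fun r hr => ?_⟩
    rw [← map_smul, h r hr, map_zero]

/-- All maximal regular sequences have the same length, namely the depth. -/
theorem IsMaximalRegularSeq.depth_eq_length [IsLocalRing A] [IsNoetherianRing A]
    [Module.Finite A T] [Nontrivial T] {xs : List A} (h : IsMaximalRegularSeq A T xs) :
    depth A T = xs.length := by
  obtain ⟨hxm, hxs, hmax⟩ := h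
  have := hxs.quot_ofList_smul_nontrivial ⊤
  -- no element of the maximal ideal is regular modulo `xs`, so the residue field embeds
  have hs : ∃ t : T ⧸ (Ideal.ofList xs • ⊤ : Submodule A T),
      t ≠ 0 ∧ ∀ r ∈ IsLocalRing.maximalIdeal A, r • t = 0 := by
    by_contra hcon
    have hsub : Subsingleton ((A ⧸ IsLocalRing.maximalIdeal A) →ₗ[A]
        T ⧸ (Ideal.ofList xs • ⊤ : Submodule A T)) := by
      refine subsingleton_of_forall_eq 0 fun f => ?_
      have h1 : f 1 = 0 := by
        by_contra hne
        refine hcon ⟨f 1, hne, fun r hr => ?_⟩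
        rw [← map_smul]
        have : r • (1 : A ⧸ IsLocalRing.maximalIdeal A) = 0 := by
          simpa [Algebra.smul_def] using Ideal.Quotient.eq_zero_iff_mem.2 hr
        rw [this, map_zero]
      refine LinearMap.ext fun x => ?_
      obtain ⟨x, rfl⟩ := Ideal.Quotient.mk_surjective x
      have : (Ideal.Quotient.mk (IsLocalRing.maximalIdeal A)) x = x • 1 := by
        simp [Algebra.smul_def]
      rw [this, map_smul, h1, smul_zero]
      rfl
    obtain ⟨y, hy, hreg⟩ := IsSMulRegular.subsingleton_linearMap_iff.1 hsub
    rw [Ideal.annihilator_quotient] at hy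
    refine hmax y hy (IsRegular.of_isWeaklyRegular_of_mem_maximalIdeal T ?_ ?_)
    · simp only [List.mem_append, List.mem_singleton]
      rintro z (hz | rfl)
      exacts [hxm z hz, hy]
    · rw [isWeaklyRegular_append_iff, isWeaklyRegular_singleton_iff]
      exact ⟨hxs.1, hreg⟩
  refine le_antisymm (iSup₂_le fun ys hy => Nat.cast_le.2 ?_)
    (le_iSup₂_of_le xs ⟨hxm, hxs⟩ le_rfl)
  by_contra! hlt
  exact not_subsingleton_ext_of_isWeaklyRegular hxs.1 hxm hs
    (subsingleton_ext_of_isWeaklyRegular hy.2.1 hy.1 _ hlt)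

/-- In a Cohen-Macaulay local ring, regular sequences of length the depth are systems of
parameters. -/
theorem IsCohenMacaulay.isSystemOfParameters [IsLocalRing A] [IsNoetherianRing A]
    (hA : IsCohenMacaulay A) {xs : List A} (hxs : IsWeaklyRegular A xs)
    (hxm : ∀ x ∈ xs, x ∈ IsLocalRing.maximalIdeal A) (hlen : depth A A = xs.length) :
    IsSystemOfParameters A xs := by
  have hdim : ringKrullDim A = (xs.length : WithBot ℕ∞) := by
    rw [← hA, hlen]
    rfl
  refine ⟨hdim.symm, ?_⟩
  have hreg := IsRegular.of_isWeaklyRegular_of_mem_maximalIdeal A hxm hxs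
  have h0 : ringKrullDim (A ⧸ Ideal.ofList xs) = 0 := by
    have := ringKrullDim_add_length_eq_ringKrullDim_of_isRegular xs hreg
    rw [hdim] at this
    generalize ringKrullDim (A ⧸ Ideal.ofList xs) = d at this
    induction d with
    | bot => simp at this
    | coe d =>
      induction d with
      | top =>
        rw [show ((xs.length : ℕ) : WithBot ℕ∞) = ((xs.length : ℕ∞) : WithBot ℕ∞) from rfl,
          ← WithBot.coe_add, WithBot.coe_inj, top_add] at this
        exact absurd this.symm (ENat.natCast_ne_top _)
      | coe d =>
        norm_cast at this ⊢
        omega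
  have hle : Ideal.ofList xs ≤ IsLocalRing.maximalIdeal A := Ideal.span_le.2 hxm
  have : Ring.KrullDimLE 0 (A ⧸ Ideal.ofList xs) := by
    rw [Ring.krullDimLE_iff, h0]
    rfl
  refine le_antisymm ?_ ?_
  · exact (Ideal.radical_mono hle).trans (Ideal.IsPrime.radical inferInstance).le
  · rw [Ideal.radical_eq_sInf]
    refine le_sInf fun P ⟨hP, hPp⟩ => ?_
    have h1 : (P.map (Ideal.Quotient.mk (Ideal.ofList xs))).IsPrime :=
      Ideal.map_isPrime_of_surjective Ideal.Quotient.mk_surjective (by simpa using hP)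
    have h2 := h1.isMaximal'
    have h3 := Ideal.comap_isMaximal_of_surjective _ Ideal.Quotient.mk_surjective
      (K := P.map (Ideal.Quotient.mk (Ideal.ofList xs)))
    rw [Ideal.comap_map_of_surjective _ Ideal.Quotient.mk_surjective, ← RingHom.ker_eq_comap_bot,
      Ideal.mk_ker, sup_eq_left.2 hP] at h3
    exact (IsLocalRing.eq_maximalIdeal h3).ge

/-- Iterating `F`-injectivity: the Frobenius maps between quotients by the Frobenius powers of a
system of parameters are injective. -/
theorem IsFInjective.mem_of_pow_mem [IsLocalRing A] {p : ℕ} [Fact p.Prime] [CharP A p]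
    (hA : IsFInjective A p) {xs : List A}
    (hxs : ∀ e : ℕ, IsSystemOfParameters A (xs.map (· ^ p ^ e))) {e : ℕ} (k : ℕ) {x : A}
    (hx : x ^ p ^ k ∈ Ideal.ofList (xs.map (· ^ p ^ (e + k)))) :
    x ∈ Ideal.ofList (xs.map (· ^ p ^ e)) := by
  induction k with
  | zero => simpa using hx
  | succ k ih =>
    refine ih (hA _ (hxs (e + k)) _ ?_)
    rw [← pow_mul, ← pow_succ]
    refine Ideal.span_le.2 (fun y hy => ?_) hx
    obtain ⟨z, hz, rfl⟩ := List.mem_map.1 hy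
    refine Ideal.subset_span ⟨z ^ p ^ (e + k), Ideal.subset_span (List.mem_map.2 ⟨z, hz, rfl⟩), ?_⟩
    simp only [← pow_mul, ← pow_succ, add_assoc]

/-- The socle of the quotient by a system of parameters contains the last nonzero power of the
maximal ideal. -/
theorem IsSystemOfParameters.exists_socle [IsLocalRing A] [IsNoetherianRing A] {xs : List A}
    (hxs : IsSystemOfParameters A xs) :
    ∃ w : A, w ∉ Ideal.ofList xs ∧ ∀ y ∈ IsLocalRing.maximalIdeal A, y * w ∈ Ideal.ofList xs := by
  classical
  have hex := Ideal.exists_radical_pow_le_of_fg (Ideal.ofList xs) (IsNoetherian.noetherian _)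
  rw [hxs.2] at hex
  have hk := Nat.find_spec hex
  have hmin := fun j => Nat.find_min hex (m := j)
  generalize Nat.find hex = k at hk hmin
  cases k with
  | zero =>
    have h1 : Ideal.ofList xs = ⊤ := by simpa using hk
    have := hxs.2
    rw [h1, Ideal.radical_top] at this
    exact absurd this.symm (Ideal.IsPrime.ne_top inferInstance)
  | succ k =>
    obtain ⟨w, hw, hw'⟩ := SetLike.not_le_iff_exists.1 (hmin k (by omega))
    refine ⟨w, hw', fun y hy => hk ?_⟩
    rw [pow_succ']
    exact Ideal.mul_mem_mul hy hw

end Depth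

end

end PhantomDepth

/-! ### Frobenius powers and base change -/

namespace PhantomDepth

section

open scoped Pointwise
open RingTheory.Sequence

section BaseChange

variable {R S : Type u} [CommRing R] [CommRing S] [Algebra R S] {p : ℕ} [Fact p.Prime]
  [CharP R p] [CharP S p]

variable (S p) in
/-- The map `F^e_R(N) → F^e_S(S ⊗ N)`, `a ⊗ n ↦ a ⊗ (1 ⊗ n)`. -/
noncomputable def frobBase (e : ℕ) (N : Type v) [AddCommGroup N] [Module R N] :
    FrobPow R p e N →ₛₗ[algebraMap R S] FrobPow S p e (S ⊗[R] N) :=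
  frobLift (algebraMap R S) e
    ((frobEltHom S p e (S ⊗[R] N)).comp (TensorProduct.mk R S N 1).toAddMonoidHom) fun r m => by
      change frobElt S p e ((1 : S) ⊗ₜ[R] (r • m)) = _ • frobElt S p e ((1 : S) ⊗ₜ[R] m)
      rw [map_pow, ← frobElt_smul, TensorProduct.tmul_smul, algebraMap_smul]

variable {N : Type v} [AddCommGroup N] [Module R N] {e : ℕ}

theorem frobBase_frobElt (n : N) :
    frobBase S p e N (frobElt R p e n) = frobElt S p e ((1 : S) ⊗ₜ[R] n) :=
  frobLift_frobElt _ _ _ _ _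

/-- Base change commutes with the Frobenius actions. -/
theorem frobBase_frobPush (k : ℕ) (v : FrobPow R p e N) :
    frobBase S p (e + k) N (frobPush R p e k N v) =
      frobPush S p e k (S ⊗[R] N) (frobBase S p e N v) := by
  induction v using FrobPow.induction with
  | h r m => simp only [map_smulₛₗ, frobPush_frobElt, frobBase_frobElt, map_pow,
      iterateFrobenius_def]
  | hadd v w hv hw => simp only [map_add, hv, hw]

variable (S p N e) in
/-- The Frobenius power commutes with base change: `S ⊗ F^e_R(N) ≃ F^e_S(S ⊗ N)`. -/
noncomputable def frobBaseEquiv : S ⊗[R] FrobPow R p e N ≃ₗ[S] FrobPow S p e (S ⊗[R] N) :=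
  letI : Module R (FrobPow S p e (S ⊗[R] N)) := Module.compHom _ (algebraMap R S)
  haveI : IsScalarTower R S (FrobPow S p e (S ⊗[R] N)) := .of_algebraMap_smul fun _ _ => rfl
  let ψ : FrobPow R p e N →ₗ[R] FrobPow S p e (S ⊗[R] N) :=
    { toFun := frobBase S p e N
      map_add' := map_add _
      map_smul' := (frobBase S p e N).map_smulₛₗ }
  let g : S ⊗[R] N →+ S ⊗[R] FrobPow R p e N := TensorProduct.liftAddHom
    { toFun := fun s => ((TensorProduct.mk R S (FrobPow R p e N) (s ^ p ^ e)).toAddMonoidHom).comp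
        (frobEltHom R p e N)
      map_zero' := by
        ext n
        simp [zero_pow (pow_ne_zero e (Fact.out : p.Prime).ne_zero)]
      map_add' := fun s t => by
        ext n
        simp [add_pow_char_pow] }
    (fun r s n => by
      change ((r • s) ^ p ^ e) ⊗ₜ[R] frobElt R p e n = (s ^ p ^ e) ⊗ₜ[R] frobElt R p e (r • n)
      rw [frobElt_smul, TensorProduct.tmul_smul, TensorProduct.smul_tmul', smul_pow])
  have hg : ∀ (s : S) n, g (s ⊗ₜ n) = (s ^ p ^ e) ⊗ₜ[R] frobElt R p e n := fun s n => rfl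
  let l : FrobPow S p e (S ⊗[R] N) →ₗ[S] S ⊗[R] FrobPow R p e N :=
    frobLift (RingHom.id S) e g fun s x => by
      induction x using TensorProduct.induction_on with
      | zero => simp
      | tmul t n =>
        rw [TensorProduct.smul_tmul', hg, hg, RingHom.id_apply, TensorProduct.smul_tmul',
          smul_eq_mul, smul_eq_mul, mul_pow]
      | add x y hx hy => rw [smul_add, map_add, map_add, hx, hy, smul_add]
  LinearEquiv.ofLinearMap (ψ.liftBaseChange S) l
    (FrobPow.hom_ext fun x => by
      induction x using TensorProduct.induction_on with
      | zero => rw [frobElt_zero, map_zero, map_zero]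
      | tmul t n =>
        simp only [LinearMap.comp_apply, LinearMap.id_apply, l, frobLift_frobElt, hg,
          LinearMap.liftBaseChange_tmul]
        change t ^ p ^ e • frobBase S p e N (frobElt R p e n) = _
        rw [frobBase_frobElt, ← frobElt_smul, TensorProduct.smul_tmul', smul_eq_mul, mul_one]
      | add x y hx hy => rw [frobElt_add, map_add, map_add, hx, hy])
    (by
      have hl (v : FrobPow R p e N) : l (frobBase S p e N v) = (1 : S) ⊗ₜ v := by
        induction v using FrobPow.induction with
        | h r n =>
          rw [map_smulₛₗ, frobBase_frobElt, map_smul]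
          simp only [l, frobLift_frobElt, hg, one_pow]
          rw [algebraMap_smul, TensorProduct.tmul_smul]
        | hadd v w hv hw => rw [map_add, map_add, hv, hw, TensorProduct.tmul_add]
      refine LinearMap.ext fun x => ?_
      induction x using TensorProduct.induction_on with
      | zero => rw [map_zero, map_zero]
      | tmul s v =>
        simp only [LinearMap.comp_apply, LinearMap.id_apply, LinearMap.liftBaseChange_tmul]
        change l (s • frobBase S p e N v) = _
        rw [map_smul, hl, TensorProduct.smul_tmul', smul_eq_mul, mul_one]
      | add x y hx hy => rw [map_add, map_add, hx, hy])

theorem frobBaseEquiv_tmul (s : S) (v : FrobPow R p e N) :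
    frobBaseEquiv S p N e (s ⊗ₜ v) = s • frobBase S p e N v := rfl

end BaseChange

end

end PhantomDepth

/-! ### Base change of phantom regular sequences -/

namespace PhantomDepth

section

open scoped Pointwise
open RingTheory.Sequence

section RegularBaseChange

variable {R S : Type u} [CommRing R] [CommRing S] [Algebra R S] {p : ℕ} [Fact p.Prime]
  [CharP R p] [CharP S p]

/-- A weak test element of `R` whose image lies in `S°` carries the tight closure of `0` over to
`S`. -/
theorem frobBase_mem_tightClosure_bot {e₀ : ℕ} {c : R} (hcR : IsWeakTestElement R p e₀ c)
    (hcS : algebraMap R S c ∈ minPrimesCompl S) {N : Type u} [AddCommGroup N] [Module R N]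
    [Module.Finite R N] {e : ℕ} {v : FrobPow R p e N}
    (hv : v ∈ tightClosure R p (⊥ : Submodule R (FrobPow R p e N))) :
    frobBase S p e N v ∈ tightClosure S p (⊥ : Submodule S (FrobPow S p e (S ⊗[R] N))) := by
  refine (mem_tightClosure_bot_iff _).2 ⟨_, hcS, e₀, fun k hk => ?_⟩
  rw [← frobBase_frobPush, ← map_smulₛₗ, hcR.smul_frobPush_eq_zero hv hk, map_zero]

/-- By flatness the kernel of `x ^ p ^ e` on `F^e(S ⊗ N) ≃ S ⊗ F^e(N)` is the base change of its
kernel on `F^e(N)`, which lies in the tight closure of `0`. -/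
theorem IsPhantomRegular.baseChange [IsLocalRing R] [IsLocalRing S] [Module.Flat R S]
    [IsLocalHom (algebraMap R S)] {e₀ : ℕ} {c : R} (hcR : IsWeakTestElement R p e₀ c)
    (hcS : algebraMap R S c ∈ minPrimesCompl S) {N : Type u} [AddCommGroup N] [Module R N]
    [Module.Finite R N] {x : R} (hx : IsPhantomRegular R p N x)
    (hxm : x ∈ IsLocalRing.maximalIdeal R) :
    IsPhantomRegular S p (S ⊗[R] N) (algebraMap R S x) := by
  have : Nontrivial N := by
    by_contra hN
    rw [not_nontrivial_iff_subsingleton] at hN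
    exact hx.1 (Subsingleton.elim _ _)
  have := Module.FaithfullyFlat.of_flat_of_isLocalHom (A := R) (B := S)
  refine ⟨?_, fun e z hz => ?_⟩
  · rw [← Ideal.ofList_singleton]
    refine ofList_smul_top_ne_top fun y hy => ?_
    rw [List.mem_singleton.1 hy]
    exact fun h => hxm (isUnit_of_map_unit (algebraMap R S) x h)
  · obtain ⟨y, rfl⟩ := (frobBaseEquiv S p N e).surjective z
    let f : FrobPow R p e N →ₗ[R] FrobPow R p e N := LinearMap.lsmul R _ (x ^ p ^ e)
    have hf : f.baseChange S y = 0 := by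
      have h1 : f.baseChange S y = algebraMap R S x ^ p ^ e • y := by
        clear hz
        induction y using TensorProduct.induction_on with
        | zero => rw [map_zero, smul_zero]
        | tmul s v =>
          rw [LinearMap.baseChange_tmul, ← map_pow, algebraMap_smul]
          exact TensorProduct.tmul_smul _ _ _
        | add a b ha hb => rw [map_add, smul_add, ha, hb]
      rw [h1, ← (frobBaseEquiv S p N e).map_eq_zero_iff, map_smul, hz]
    obtain ⟨y, rfl⟩ := ((Module.Flat.lTensor_exact S (LinearMap.exact_subtype_ker_map f)) y).1 hf
    clear hz hf
    induction y using TensorProduct.induction_on with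
    | zero => rw [map_zero, map_zero]; exact Submodule.zero_mem _
    | tmul s v =>
      rw [LinearMap.lTensor_tmul, frobBaseEquiv_tmul]
      exact Submodule.smul_mem _ _ (frobBase_mem_tightClosure_bot hcR hcS (hx.2 e v.1 v.2))
    | add a b ha hb => rw [map_add, map_add]; exact Submodule.add_mem _ ha hb

/-- `F^e(P / xP) ≃ F^e(P) / x^{p^e} F^e(P)`. -/
noncomputable def frobPowQuotSMulTopEquiv (e : ℕ) (P : Type v) [AddCommGroup P] [Module R P]
    (x : R) :
    QuotSMulTop (x ^ p ^ e) (FrobPow R p e P) ≃ₗ[R] FrobPow R p e (QuotSMulTop x P) :=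
  (Submodule.quotEquivOfEq _ _ (ker_frobMap_mkQ_smul x).symm).trans
    ((frobMap R p e (x • (⊤ : Submodule R P)).mkQ).quotKerEquivOfSurjective
      (frobMap_surjective (Submodule.mkQ_surjective _)))

theorem isPhantomRegularSeq_of_isWeaklyRegular {P : Type v} [AddCommGroup P] [Module R P]
    {zs : List R} (hP : (Ideal.ofList zs • ⊤ : Submodule R P) ≠ ⊤)
    (h : ∀ e : ℕ, IsWeaklyRegular (FrobPow R p e P) (zs.map (· ^ p ^ e))) :
    IsPhantomRegularSeq R p P zs := by
  induction zs generalizing P with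
  | nil => exact ⟨hP, by simp⟩
  | cons z zs ih =>
    rw [isPhantomRegularSeq_cons_iff]
    simp only [List.map_cons, isWeaklyRegular_cons_iff] at h
    have h1 (e : ℕ) : IsWeaklyRegular (FrobPow R p e (QuotSMulTop z P)) (zs.map (· ^ p ^ e)) :=
      ((frobPowQuotSMulTopEquiv e P z).isWeaklyRegular_congr _).1 (h e).2
    have h2 : Ideal.span {z} ≤ Ideal.ofList (z :: zs) := Ideal.span_mono (by simp)
    refine ⟨⟨fun htop => hP (eq_top_iff.2 (htop.ge.trans (Submodule.smul_mono_left h2))),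
      fun e v hv => ?_⟩,
      ih (fun htop => hP ((Submodule.top_eq_ofList_cons_smul_iff z zs).2 htop.symm).symm) h1⟩
    rw [(h e).1.right_eq_zero_of_smul hv]
    exact Submodule.zero_mem _

end RegularBaseChange

section Local

variable {R S : Type u} [CommRing R] [CommRing S] [Algebra R S] {p : ℕ} [Fact p.Prime]
  [CharP R p] [CharP S p] [IsLocalRing R] [IsLocalRing S] [IsNoetherianRing R]
  [IsNoetherianRing S] [IsLocalHom (algebraMap R S)] [Module.Flat R S]

theorem isWeaklyRegular_map_pow_frobPow {zs : List S}
    (hzs : IsWeaklyRegular (ClosedFiber R S) zs)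
    (hzm : ∀ z ∈ zs, z ∈ IsLocalRing.maximalIdeal S) (N : Type u) [AddCommGroup N] [Module R N]
    [Module.Finite R N] (e : ℕ) :
    IsWeaklyRegular (FrobPow S p e (S ⊗[R] N)) (zs.map (· ^ p ^ e)) := by
  obtain ⟨n, hn⟩ := Nat.exists_eq_succ_of_ne_zero
    (pow_ne_zero e (Fact.out : p.Prime).ne_zero)
  have h := isWeaklyRegular_map_pow hzs hzm n
  rw [← Nat.succ_eq_add_one, ← hn] at h
  exact ((frobBaseEquiv S p N e).isWeaklyRegular_congr _).1 (isWeaklyRegular_tensor h _)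

/-- The part `φ(as)` is split off by flatness, element by element; what remains is `zs` on `S ⊗ N`.
-/
theorem IsPhantomRegularSeq.baseChange_append {e₀ : ℕ} {c : R}
    (hcR : IsWeakTestElement R p e₀ c) (hcS : algebraMap R S c ∈ minPrimesCompl S)
    {as : List R} (ham : ∀ a ∈ as, a ∈ IsLocalRing.maximalIdeal R) {zs : List S}
    (hzm : ∀ z ∈ zs, z ∈ IsLocalRing.maximalIdeal S)
    (hzs : IsWeaklyRegular (ClosedFiber R S) zs)
    {N : Type u} [AddCommGroup N] [Module R N] [Module.Finite R N]
    (has : IsPhantomRegularSeq R p N as) :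
    IsPhantomRegularSeq S p (S ⊗[R] N) (as.map (algebraMap R S) ++ zs) := by
  induction as generalizing N with
  | nil =>
    have : Nontrivial N := by
      by_contra hN
      rw [not_nontrivial_iff_subsingleton] at hN
      exact has.1 (Subsingleton.elim _ _)
    have := Module.FaithfullyFlat.of_flat_of_isLocalHom (A := R) (B := S)
    exact isPhantomRegularSeq_of_isWeaklyRegular (ofList_smul_top_ne_top hzm)
      (isWeaklyRegular_map_pow_frobPow hzs hzm N)
  | cons a as ih =>
    rw [isPhantomRegularSeq_cons_iff] at has
    rw [List.map_cons, List.cons_append, isPhantomRegularSeq_cons_iff]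
    exact ⟨has.1.baseChange hcR hcS (ham a (by simp)),
      (isPhantomRegularSeq_congr
        (QuotSMulTop.algebraMapTensorEquivTensorQuotSMulTop a N S) _).2
        (ih (fun b hb => ham b (by simp [hb])) has.2)⟩

end Local

end

end PhantomDepth

/-! ### Base change of phantom socles -/

namespace PhantomDepth

section

open scoped Pointwise
open RingTheory.Sequence

section Socle

variable {R S : Type u} [CommRing R] [CommRing S] [Algebra R S] [IsLocalRing R]

variable (R S) in
theorem charP_closedFiber [IsLocalRing S] [IsLocalHom (algebraMap R S)] (p : ℕ)
    [Fact p.Prime] [CharP S p] : CharP (ClosedFiber R S) p :=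
  ringChar.of_eq <| CharP.ringChar_of_prime_eq_zero Fact.out <| by
    rw [← map_natCast (Ideal.Quotient.mk ((IsLocalRing.maximalIdeal R).map (algebraMap R S))),
      CharP.cast_eq_zero, map_zero]

theorem algebraMap_closedFiber_mem_ofList_map_iff {zs : List S} {s : S} :
    algebraMap S (ClosedFiber R S) s ∈
        Ideal.ofList (zs.map (algebraMap S (ClosedFiber R S))) ↔
      s ∈ (IsLocalRing.maximalIdeal R).map (algebraMap R S) ⊔ Ideal.ofList zs := by
  rw [← Ideal.map_ofList, sup_comm]
  exact Ideal.mem_quotient_iff_mem_sup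

theorem algebraMap_closedFiber_mem_maximalIdeal_iff [IsLocalRing S]
    [IsLocalHom (algebraMap R S)] {s : S} :
    algebraMap S (ClosedFiber R S) s ∈ IsLocalRing.maximalIdeal (ClosedFiber R S) ↔
      s ∈ IsLocalRing.maximalIdeal S := by
  have : IsLocalHom (algebraMap S (ClosedFiber R S)) :=
    IsLocalHom.of_surjective _ Ideal.Quotient.mk_surjective
  exact (isUnit_map_iff (algebraMap S (ClosedFiber R S)) s).not

theorem map_algebraMap_closedFiber_mem_maximalIdeal [IsLocalRing S]
    [IsLocalHom (algebraMap R S)] {zs : List S}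
    (hzm : ∀ z ∈ zs, z ∈ IsLocalRing.maximalIdeal S) :
    ∀ z ∈ zs.map (algebraMap S (ClosedFiber R S)),
      z ∈ IsLocalRing.maximalIdeal (ClosedFiber R S) := by
  intro z hz
  obtain ⟨y, hy, rfl⟩ := List.mem_map.1 hz
  exact algebraMap_closedFiber_mem_maximalIdeal_iff.2 (hzm y hy)

variable {p : ℕ} [Fact p.Prime] [IsLocalRing S] [IsNoetherianRing S] [IsLocalHom (algebraMap R S)]

theorem isSystemOfParameters_closedFiber_map_pow (hCM : IsCohenMacaulay (ClosedFiber R S))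
    {zs : List S} (hzm : ∀ z ∈ zs, z ∈ IsLocalRing.maximalIdeal S)
    (hzs : IsWeaklyRegular (ClosedFiber R S) zs)
    (hlen : depth (ClosedFiber R S) (ClosedFiber R S) = zs.length) (e : ℕ) :
    IsSystemOfParameters (ClosedFiber R S)
      ((zs.map (algebraMap S (ClosedFiber R S))).map (· ^ p ^ e)) := by
  obtain ⟨n, hn⟩ := Nat.exists_eq_succ_of_ne_zero
    (pow_ne_zero e (Fact.out : p.Prime).ne_zero)
  have hzm' : ∀ z ∈ zs.map (algebraMap S (ClosedFiber R S)),
      z ∈ IsLocalRing.maximalIdeal (ClosedFiber R S) :=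
    map_algebraMap_closedFiber_mem_maximalIdeal hzm
  rw [hn]
  refine hCM.isSystemOfParameters (isWeaklyRegular_map_pow
    ((isWeaklyRegular_map_algebraMap_iff (ClosedFiber R S) (ClosedFiber R S) zs).2 hzs) hzm' n)
    (fun x hx => ?_) (by simpa using hlen)
  obtain ⟨y, hy, rfl⟩ := List.mem_map.1 hx
  exact Ideal.pow_mem_of_mem _ (hzm' y hy) _ n.succ_pos

variable [CharP R p] [CharP S p] [IsNoetherianRing R] [Module.Flat R S]

/-- If `u` is a phantom socle element of `N` and `w` represents a socle element of the closed fiber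
modulo the `p ^ e`-th powers of a system of parameters `zs`, then `w ⊗ u` is a phantom socle element
of `(S ⊗ N) / zs (S ⊗ N)`. It stays outside the tight closure of `0` because, by `F`-injectivity,
the `p ^ k`-th powers of `w` avoid the powers of the parameters. -/
theorem HasPhantomSocle.tensor_quotient (hCM : IsCohenMacaulay (ClosedFiber R S))
    (hFI : IsFInjective (ClosedFiber R S) p) {e₀ : ℕ} {c : R}
    (hcR : IsWeakTestElement R p e₀ c) (hcS : IsWeakTestElement S p e₀ (algebraMap R S c))
    {zs : List S} (hzm : ∀ z ∈ zs, z ∈ IsLocalRing.maximalIdeal S)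
    (hzs : IsWeaklyRegular (ClosedFiber R S) zs)
    (hlen : depth (ClosedFiber R S) (ClosedFiber R S) = zs.length)
    {N : Type u} [AddCommGroup N] [Module R N] [Module.Finite R N]
    (h : HasPhantomSocle p (IsLocalRing.maximalIdeal R) N) :
    HasPhantomSocle p (IsLocalRing.maximalIdeal S)
      ((S ⊗[R] N) ⧸ (Ideal.ofList zs • ⊤ : Submodule S (S ⊗[R] N))) := by
  have := charP_closedFiber R S p
  obtain ⟨e, u, hu, hmu⟩ := h
  have hsop := isSystemOfParameters_closedFiber_map_pow (p := p) hCM hzm hzs hlen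
  obtain ⟨w', hw', hmw'⟩ := (hsop e).exists_socle
  obtain ⟨w, rfl⟩ : ∃ w, algebraMap S (ClosedFiber R S) w = w' := Ideal.Quotient.mk_surjective w'
  have hcomm (j : ℕ) : (zs.map (algebraMap S (ClosedFiber R S))).map (· ^ p ^ j) =
      (zs.map (· ^ p ^ j)).map (algebraMap S (ClosedFiber R S)) := by
    simp
  refine ⟨e, frobMap S p e (Submodule.mkQ _) (w • frobBase S p e N u), fun hg => hu ?_,
    fun y hy => ?_⟩
  · refine (mem_tightClosure_bot_iff _).2 ⟨c, hcR.1, e₀, fun k hk => ?_⟩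
    have h1 := hcS.smul_frobPush_eq_zero hg hk
    rw [← frobMap_frobPush, ← map_smul, ← LinearMap.mem_ker, ker_frobMap_mkQ_ofList,
      frobPush_smul, smul_comm, ← frobBase_frobPush, ← map_smulₛₗ, ← frobBaseEquiv_tmul] at h1
    -- `w ^ p ^ k ⊗ c F^k(u)` vanishes modulo the `p ^ (e + k)`-th powers of the parameters
    have h2 : (w ^ p ^ k) ⊗ₜ[R] (c • frobPush R p e k N u) ∈
        (Ideal.ofList (zs.map (· ^ p ^ (e + k))) • ⊤ :
          Submodule S (S ⊗[R] FrobPow R p (e + k) N)) := by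
      have h3 := Submodule.mem_map_of_mem (f := (frobBaseEquiv S p N (e + k)).symm.toLinearMap) h1
      rw [Submodule.map_smul'', Submodule.map_top, LinearEquiv.range] at h3
      simpa using h3
    obtain ⟨n, hn⟩ := Nat.exists_eq_succ_of_ne_zero
      (pow_ne_zero (e + k) (Fact.out : p.Prime).ne_zero)
    have h4 : IsWeaklyRegular (ClosedFiber R S) (zs.map (· ^ p ^ (e + k))) := by
      rw [hn]
      exact isWeaklyRegular_map_pow hzs hzm n
    refine eq_zero_of_tmul_mem_ofList_smul_top h4 h2 fun hs => hw' ?_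
    rw [← algebraMap_closedFiber_mem_ofList_map_iff, ← hcomm, map_pow] at hs
    exact hFI.mem_of_pow_mem hsop k hs
  · have h1 := hmw' _ (algebraMap_closedFiber_mem_maximalIdeal_iff.2 hy)
    rw [hcomm, ← map_mul, algebraMap_closedFiber_mem_ofList_map_iff] at h1
    -- `y * w = a + b`, where `a` kills `u` up to tight closure and `b` vanishes in the quotient
    obtain ⟨a, ha, b, hb, hab⟩ := Submodule.mem_sup.1 h1
    rw [← map_smul, smul_smul, ← hab, add_smul, map_add]
    refine Submodule.add_mem _ (map_mem_tightClosure_bot _ ?_) ?_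
    · have hle : (IsLocalRing.maximalIdeal R).map (algebraMap R S) ≤
          Submodule.colon (tightClosure S p (⊥ : Submodule S (FrobPow S p e (S ⊗[R] N))))
            {frobBase S p e N u} := Ideal.map_le_iff_le_comap.2 fun r hr => by
        rw [Ideal.mem_comap, Submodule.mem_colon_singleton, ← map_smulₛₗ]
        exact frobBase_mem_tightClosure_bot hcR hcS.1 (hmu r hr)
      exact Submodule.mem_colon_singleton.1 (hle ha)
    · have h2 : b • frobBase S p e N u ∈
          LinearMap.ker (frobMap S p e (Ideal.ofList zs • ⊤ : Submodule S (S ⊗[R] N)).mkQ) := by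
        rw [ker_frobMap_mkQ_ofList]
        exact Submodule.smul_mem_smul hb trivial
      rw [LinearMap.mem_ker.1 h2]
      exact Submodule.zero_mem _

theorem HasPhantomSocle.baseChange_append (hCM : IsCohenMacaulay (ClosedFiber R S))
    (hFI : IsFInjective (ClosedFiber R S) p) {e₀ : ℕ} {c : R}
    (hcR : IsWeakTestElement R p e₀ c) (hcS : IsWeakTestElement S p e₀ (algebraMap R S c))
    {as : List R} {zs : List S} (hzm : ∀ z ∈ zs, z ∈ IsLocalRing.maximalIdeal S)
    (hzs : IsWeaklyRegular (ClosedFiber R S) zs)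
    (hlen : depth (ClosedFiber R S) (ClosedFiber R S) = zs.length)
    {N : Type u} [AddCommGroup N] [Module R N] [Module.Finite R N]
    (h : HasPhantomSocle p (IsLocalRing.maximalIdeal R)
      (N ⧸ (Ideal.ofList as • ⊤ : Submodule R N))) :
    HasPhantomSocle p (IsLocalRing.maximalIdeal S)
      ((S ⊗[R] N) ⧸ (Ideal.ofList (as.map (algebraMap R S) ++ zs) • ⊤ :
        Submodule S (S ⊗[R] N))) := by
  induction as generalizing N with
  | nil => exact (h.congr (quotOfListNil N)).tensor_quotient hCM hFI hcR hcS hzm hzs hlen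
  | cons a as ih =>
    have h1 := ih (h.congr (Submodule.quotOfListConsSMulTopEquivQuotSMulTopInner N a as))
    refine (h1.congr (Submodule.Quotient.equiv _ _
      (QuotSMulTop.algebraMapTensorEquivTensorQuotSMulTop a N S).symm ?_)).congr
      (Submodule.quotOfListConsSMulTopEquivQuotSMulTopInner (S ⊗[R] N) (algebraMap R S a)
        (as.map (algebraMap R S) ++ zs)).symm
    simp [Submodule.map_smul'']

end Socle

section MaximalRegular

variable {R S : Type u} [CommRing R] [CommRing S] [Algebra R S] [IsLocalRing R] [IsLocalRing S]
  [IsNoetherianRing S] [IsLocalHom (algebraMap R S)]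

/-- Maximal regular sequences in `S` on the closed fiber map to maximal regular sequences of the
closed fiber. -/
theorem IsMaximalRegularSeq.depth_closedFiber {zs : List S}
    (h : IsMaximalRegularSeq S (ClosedFiber R S) zs) :
    depth (ClosedFiber R S) (ClosedFiber R S) = zs.length := by
  have hm : IsMaximalRegularSeq (ClosedFiber R S) (ClosedFiber R S)
      (zs.map (algebraMap S (ClosedFiber R S))) := by
    have hzm : ∀ z ∈ zs.map (algebraMap S (ClosedFiber R S)),
        z ∈ IsLocalRing.maximalIdeal (ClosedFiber R S) :=
      map_algebraMap_closedFiber_mem_maximalIdeal h.1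
    refine ⟨hzm, IsRegular.of_isWeaklyRegular_of_mem_maximalIdeal _ hzm
      ((isWeaklyRegular_map_algebraMap_iff _ _ zs).2 h.2.1.toIsWeaklyRegular),
      fun y hy hreg => ?_⟩
    obtain ⟨y, rfl⟩ : ∃ x, algebraMap S (ClosedFiber R S) x = y :=
      Ideal.Quotient.mk_surjective y
    have hy' : y ∈ IsLocalRing.maximalIdeal S := algebraMap_closedFiber_mem_maximalIdeal_iff.1 hy
    refine h.2.2 y hy' (IsRegular.of_isWeaklyRegular_of_mem_maximalIdeal _ ?_ ?_)
    · simp only [List.mem_append, List.mem_singleton]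
      rintro z (hz | rfl)
      exacts [h.1 z hz, hy']
    · rw [← isWeaklyRegular_map_algebraMap_iff (ClosedFiber R S), List.map_append,
        List.map_singleton]
      exact hreg.toIsWeaklyRegular
  simpa using hm.depth_eq_length

/-- Maximal regular sequences exist, since regular sequences generate strictly increasing ideals. -/
theorem exists_isMaximalRegularSeq (T : Type u) [AddCommGroup T] [Module S T] [Module.Finite S T]
    [Nontrivial T] : ∃ zs : List S, IsMaximalRegularSeq S T zs := by
  let 𝒮 : Set (Ideal S) := {I | ∃ xs : List S, (∀ x ∈ xs, x ∈ IsLocalRing.maximalIdeal S) ∧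
    IsRegular T xs ∧ Ideal.ofList xs = I}
  obtain ⟨_, ⟨xs, hxm, hxs, rfl⟩, hmax⟩ := set_has_maximal_iff_noetherian.2
    (inferInstance : IsNoetherian S S) 𝒮 ⟨_, [], by simp, IsRegular.nil S T, rfl⟩
  refine ⟨xs, hxm, hxs, fun y hy hreg => hmax _ ⟨xs ++ [y], ?_, hreg, rfl⟩ ?_⟩
  · simp only [List.mem_append, List.mem_singleton]
    rintro z (hz | rfl)
    exacts [hxm z hz, hy]
  · rw [Ideal.ofList_append, Ideal.ofList_singleton]
    refine lt_of_le_of_ne le_sup_left fun heq => ?_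
    have hyI : y ∈ Ideal.ofList xs := by
      rw [heq]
      exact Ideal.mem_sup_right (Ideal.mem_span_singleton_self y)
    have := hxs.quot_ofList_smul_nontrivial ⊤
    obtain ⟨t, ht⟩ := exists_ne (0 : T ⧸ (Ideal.ofList xs • ⊤ : Submodule S T))
    have h1 : IsSMulRegular (T ⧸ (Ideal.ofList xs • ⊤ : Submodule S T)) y := by
      have := (isWeaklyRegular_append_iff T xs [y]).1 hreg.toIsWeaklyRegular
      exact ((isWeaklyRegular_singleton_iff _ _).1 this.2)
    refine ht (h1.right_eq_zero_of_smul ?_)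
    obtain ⟨t, rfl⟩ := Submodule.mkQ_surjective _ t
    rw [← map_smul]
    exact (Submodule.Quotient.mk_eq_zero _).2 (Submodule.smul_mem_smul hyI trivial)

end MaximalRegular

end

end PhantomDepth

theorem mainTheorem1 {p : ℕ} [Fact p.Prime]
    {R S : Type u} [CommRing R] [CommRing S] [IsLocalRing R] [IsLocalRing S]
    [IsNoetherianRing R] [IsNoetherianRing S] [CharP R p] [CharP S p]
    [Algebra R S] [IsLocalHom (algebraMap R S)] [Module.Flat R S]
    (hCM : PhantomDepth.IsCohenMacaulay (PhantomDepth.ClosedFiber R S))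
    (hFI : PhantomDepth.IsFInjective (PhantomDepth.ClosedFiber R S) p)
    (e₀ : ℕ) (c : R)
    (hcR : PhantomDepth.IsWeakTestElement R p e₀ c)
    (hcS : PhantomDepth.IsWeakTestElement S p e₀ (algebraMap R S c))
    (M : Type u) [AddCommGroup M] [Module R M] [Module.Finite R M] [Nontrivial M]
    (hM : PhantomDepth.SatisfiesAvoidance R p M) :
    (PhantomDepth.phantomDepth R p M +
        PhantomDepth.depth (PhantomDepth.ClosedFiber R S) (PhantomDepth.ClosedFiber R S) =
      PhantomDepth.phantomDepth S p (S ⊗[R] M) ∧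
    PhantomDepth.phantomDepth S p (S ⊗[R] M) ≠ ⊤) ∧
    ∀ (as : List R) (zs : List S),
      PhantomDepth.IsMaximalPhantomRegularSeq R p M as →
      PhantomDepth.IsMaximalRegularSeq S (PhantomDepth.ClosedFiber R S) zs →
      PhantomDepth.IsMaximalPhantomRegularSeq S p (S ⊗[R] M)
        (as.map (algebraMap R S) ++ zs) := by
  have key (as : List R) (zs : List S) (has : PhantomDepth.IsMaximalPhantomRegularSeq R p M as)
      (hzs : PhantomDepth.IsMaximalRegularSeq S (PhantomDepth.ClosedFiber R S) zs) :
      (∀ y ∈ as.map (algebraMap R S) ++ zs, y ∈ IsLocalRing.maximalIdeal S) ∧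
      PhantomDepth.IsPhantomRegularSeq S p (S ⊗[R] M) (as.map (algebraMap R S) ++ zs) ∧
      PhantomDepth.HasPhantomSocle p (IsLocalRing.maximalIdeal S)
        ((S ⊗[R] M) ⧸ (Ideal.ofList (as.map (algebraMap R S) ++ zs) • ⊤ :
          Submodule S (S ⊗[R] M))) := by
    refine ⟨fun y hy => ?_,
      has.2.1.baseChange_append hcR hcS.1 has.1 hzs.1 hzs.2.1.toIsWeaklyRegular,
      (has.hasPhantomSocle hM).baseChange_append hCM hFI hcR hcS hzs.1 hzs.2.1.toIsWeaklyRegular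
        hzs.depth_closedFiber⟩
    obtain hy | hy := List.mem_append.1 hy
    · obtain ⟨a, ha, rfl⟩ := List.mem_map.1 hy
      exact fun h => has.1 a ha (isUnit_of_map_unit (algebraMap R S) a h)
    · exact hzs.1 y hy
  refine ⟨?_, fun as zs has hzs => ?_⟩
  · obtain ⟨as, has⟩ := PhantomDepth.exists_isMaximalPhantomRegularSeq (R := R) p M
    obtain ⟨zs, hzs⟩ := PhantomDepth.exists_isMaximalRegularSeq (S := S)
      (PhantomDepth.ClosedFiber R S)
    obtain ⟨hm, hseq, hsoc⟩ := key as zs has hzs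
    rw [has.2.1.phantomDepth_eq_length hcR has.1 (has.hasPhantomSocle hM),
      hzs.depth_closedFiber, hseq.phantomDepth_eq_length hcS hm hsoc]
    exact ⟨by simp, ENat.natCast_ne_top _⟩
  · obtain ⟨hm, hseq, hsoc⟩ := key as zs has hzs
    exact hseq.isMaximal hcS hm hsoc
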